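/- Let $1\le k<n$, let $\mathbf x_1,\dots,\mathbf x_n\in\mathbb R^k$ be observed values of random vectors that, given $(\boldsymbol\mu,\boldsymbol\Sigma)$ with $\boldsymbol\Sigma$ positive definite, are independent and $\mathcal N_k(\boldsymbol\mu,\boldsymbol\Sigma)$-distributed, and let $\mathbf L$ be a $p\times k$ real matrix of constants. Put $$\overline{\mathbf x}_d=\frac1n\sum_{i=1}^n\mathbf x_i,\qquad \mathbf S_d=\sum_{i=1}^n(\mathbf x_i-\overline{\mathbf x}_d)(\mathbf x_i-\overline{\mathbf x}_d)^\top .$$ For $0\le t<T$, risk aversion $\gamma>0$, wealth $W_t$ at time $t$ and risk-free returns $r_{f,i}$, the multi-period optimal portfolio weights under exponential utility are $$\mathbf w_t=C_t\,\boldsymbol\Sigma^{-1}(\boldsymbol\mu-r_{f,t+1}\mathbf 1),\qquad C_t=\Big(\gamma W_t\prod_{i=t+2}^{T}(1+r_{f,i})\Big)^{-1}.$$ The distribution of $\mathbf L\mathbf w_t$ is taken under the posterior of $(\boldsymbol\mu,\boldsymbol\Sigma)$ given $\mathbf x_1,\dots,\mathbf x_n$, i.e. the probability distribution whose density with respect to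 $d\boldsymbol\mu\prod_{i\le j}d\sigma_{ij}$ on the set of $(\boldsymbol\mu,\boldsymbol\Sigma)$ with $\boldsymbol\Sigma$ positive definite is proportional to likelihood times prior. Matrix square roots are the positive semidefinite ones, and $\mathbf A^{-1/2}=(\mathbf A^{1/2})^{-1}$. For $\mathbf b\in\mathbb R^k$, a positive definite $k\times k$ matrix $\mathbf S$, $N>0$, $q\ge0$ and a unit vector $\mathbf u\in\mathbb R^k$ put $$\epsilon=\mathbf b^\top\mathbf S^{-1}\mathbf b+\frac{2}{\sqrt N}\frac{\sqrt q}{1+q}\,\mathbf b^\top\mathbf S^{-1/2}\mathbf u+\frac1N\frac{q}{1+q}-\frac{q}{1+q}\big(\mathbf b^\top\mathbf S^{-1/2}\mathbf u\big)^2,$$ $$\boldsymbol\zeta=\mathbf S^{-1}\mathbf b+\frac1{\sqrt N}\frac{\sqrt q}{1+q}\,\mathbf S^{-1/2}\mathbf u-\frac q{1+q}\,\mathbf S^{-1/2}\mathbf u\mathbf u^\top\mathbf S^{-1/2}\mathbf b,\qquad \boldsymbol\Upsilon=\mathbf S^{-1}-\frac q{1+q}\,\mathbf S^{-1/2}\mathbf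 u\mathbf u^\top\mathbf S^{-1/2}.$$ (a) Diffuse prior. Let $\pi(\boldsymbol\mu,\boldsymbol\Sigma)\propto|\boldsymbol\Sigma|^{-(k+1)/2}$ and let $\mathbf S_d$ be positive definite. Then $$\mathbf L\mathbf w_t\stackrel{d}{=}C_t\,\eta\,\mathbf L\boldsymbol\zeta+C_t\sqrt\eta\,\big(\epsilon\,\mathbf L\boldsymbol\Upsilon\mathbf L^\top-\mathbf L\boldsymbol\zeta\boldsymbol\zeta^\top\mathbf L^\top\big)^{1/2}\mathbf z_0 ,$$ where $\epsilon,\boldsymbol\zeta,\boldsymbol\Upsilon$ are taken at $\mathbf b=\overline{\mathbf x}_d-r_{f,t+1}\mathbf 1$, $\mathbf S=\mathbf S_d$, $N=n$, $q=kQ/(n-k)$ and the random vector $\mathbf u$; here $\eta\sim\chi^2_n$, $\mathbf z_0\sim\mathcal N_p(\mathbf 0,\mathbf I_p)$, $Q\sim\mathcal F(k,n-k)$, $\mathbf u$ is uniformly distributed on the unit sphere in $\mathbb R^k$, and $\eta,\mathbf z_0,Q,\mathbf u$ are mutually independent. (b) Conjugate prior. Let $\boldsymbol\mu\mid\boldsymbol\Sigma\sim\mathcal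 N_k(\mathbf m_0,\boldsymbol\Sigma/r_0)$ and $\boldsymbol\Sigma\sim\mathcal{IW}_k(d_0,\mathbf S_0)$, with $\mathbf m_0\in\mathbb R^k$, $r_0>0$, real $d_0>2k$ and $\mathbf S_0$ positive definite, where $\mathcal{IW}_k(d_0,\mathbf S_0)$ has density proportional to $|\boldsymbol\Sigma|^{-d_0/2}\exp(-\tfrac12\operatorname{tr}(\boldsymbol\Sigma^{-1}\mathbf S_0))$. Put $$\overline{\mathbf x}_c=\frac{n\overline{\mathbf x}_d+r_0\mathbf m_0}{n+r_0},\qquad \mathbf S_c=\mathbf S_d+\mathbf S_0+\frac{nr_0}{n+r_0}(\mathbf m_0-\overline{\mathbf x}_d)(\mathbf m_0-\overline{\mathbf x}_d)^\top .$$ Then the same representation of $\mathbf L\mathbf w_t$ holds with $\epsilon,\boldsymbol\zeta,\boldsymbol\Upsilon$ taken at $\mathbf b=\overline{\mathbf x}_c-r_{f,t+1}\mathbf 1$, $\mathbf S=\mathbf S_c$, $N=n+r_0$, $q=kQ/(n+d_0-2k)$ and the random vector $\mathbf u$; here $\eta\sim\chi^2_{n+d_0-k}$, $\mathbf z_0\sim\mathcal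 N_p(\mathbf 0,\mathbf I_p)$, $Q\sim\mathcal F(k,n+d_0-2k)$, $\mathbf u$ is uniformly distributed on the unit sphere in $\mathbb R^k$, and $\eta,\mathbf z_0,Q,\mathbf u$ are mutually independent. -/

import Mathlib

open MeasureTheory ProbabilityTheory Matrix
open scoped MatrixOrder ENNReal

noncomputable section

namespace BayesPortfolio

/-! ### Parameter space of the normal model -/

/-- Positions `(i, j)` with `i ≤ j`: the free entries of a symmetric `k × k` matrix. -/
abbrev UpperIdx (k : ℕ) : Type := {ij : Fin k × Fin k // ij.1 ≤ ij.2}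

/-- The symmetric matrix with the given entries on and above the diagonal. -/
def symMatrix {k : ℕ} (s : UpperIdx k → ℝ) : Matrix (Fin k) (Fin k) ℝ :=
  Matrix.of fun i j =>
    if h : i ≤ j then s ⟨(i, j), h⟩ else s ⟨(j, i), (not_le.mp h).le⟩

/-- A parameter `(μ, Σ)`: the mean vector, and the free entries of the symmetric matrix `Σ`.
The volume on this type is the Lebesgue measure `dμ ∏_{i ≤ j} dσ_{ij}`. -/
abbrev Param (k : ℕ) : Type := (Fin k → ℝ) × (UpperIdx k → ℝ)

/-- The mean vector `μ`. -/
def Param.mean {k : ℕ} (θ : Param k) : Fin k → ℝ := θ.1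

/-- The covariance matrix `Σ`. -/
def Param.cov {k : ℕ} (θ : Param k) : Matrix (Fin k) (Fin k) ℝ := symMatrix θ.2

/-- Lebesgue measure on the parameters `(μ, Σ)` with `Σ` positive definite. -/
def paramVolume (k : ℕ) : Measure (Param k) :=
  (volume : Measure (Param k)).restrict {θ | (Param.cov θ).PosDef}

/-! ### Densities -/

/-- Density at `y` of the normal distribution `N_k(m, V)`, for `V` positive definite. -/
def normalDensity {k : ℕ} (m : Fin k → ℝ) (V : Matrix (Fin k) (Fin k) ℝ) (y : Fin k → ℝ) : ℝ :=
  (2 * Real.pi) ^ (-(k : ℝ) / 2) * V.det ^ (-(1 : ℝ) / 2) *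
    Real.exp (-((y - m) ⬝ᵥ (V⁻¹ *ᵥ (y - m))) / 2)

/-- The multivariate gamma function `Γ_k(a)`. -/
def multivariateGamma (k : ℕ) (a : ℝ) : ℝ :=
  Real.pi ^ ((k : ℝ) * ((k : ℝ) - 1) / 4) * ∏ i : Fin k, Real.Gamma (a - (i : ℝ) / 2)

/-- Density at the positive definite matrix `V` of the inverse Wishart distribution `IW_k(d, S)`,
in the parametrization in which `V⁻¹` has the Wishart distribution `W_k(d - k - 1, S⁻¹)`.
It is a probability density for `d > 2k` and `S` positive definite. -/
def invWishartDensity {k : ℕ} (d : ℝ) (S V : Matrix (Fin k) (Fin k) ℝ) : ℝ :=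
  S.det ^ ((d - k - 1) / 2) /
      (2 ^ ((d - k - 1) * k / 2) * multivariateGamma k ((d - k - 1) / 2)) *
    V.det ^ (-d / 2) * Real.exp (-(V⁻¹ * S).trace / 2)

/-- Likelihood of the observations `x`, which are i.i.d. `N_k(μ, Σ)` given `(μ, Σ)`. -/
def likelihood {k n : ℕ} (x : Fin n → Fin k → ℝ) (θ : Param k) : ℝ :=
  ∏ i, normalDensity θ.mean θ.cov (x i)

/-- Jeffreys' (diffuse, improper) prior `|Σ|^{-(k+1)/2}`. -/
def diffusePrior (k : ℕ) (θ : Param k) : ℝ :=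
  θ.cov.det ^ (-((k : ℝ) + 1) / 2)

/-- The conjugate prior `μ | Σ ∼ N_k(m₀, Σ / r₀)`, `Σ ∼ IW_k(d₀, S₀)`. -/
def conjugatePrior {k : ℕ} (m₀ : Fin k → ℝ) (r₀ d₀ : ℝ) (S₀ : Matrix (Fin k) (Fin k) ℝ)
    (θ : Param k) : ℝ :=
  normalDensity m₀ (r₀⁻¹ • θ.cov) θ.mean * invWishartDensity d₀ S₀ θ.cov

/-- The measure with density likelihood times prior. -/
def unnormalizedPosterior {k n : ℕ} (prior : Param k → ℝ) (x : Fin n → Fin k → ℝ) :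
    Measure (Param k) :=
  (paramVolume k).withDensity fun θ => ENNReal.ofReal (likelihood x θ * prior θ)

/-- The posterior distribution of `(μ, Σ)` given the observations `x`: the probability measure
whose density is proportional to likelihood times prior. -/
def posteriorDist {k n : ℕ} (prior : Param k → ℝ) (x : Fin n → Fin k → ℝ) : Measure (Param k) :=
  (unnormalizedPosterior prior x Set.univ)⁻¹ • unnormalizedPosterior prior x

/-! ### Optimal portfolio weights -/

/-- `C_t = (γ W_t ∏_{i=t+2}^T (1 + r_{f,i}))⁻¹`, where `W` is the wealth at time `t`. -/
def portfolioConst (γ W : ℝ) (rf : ℕ → ℝ) (t T : ℕ) : ℝ :=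
  (γ * W * ∏ i ∈ Finset.Icc (t + 2) T, (1 + rf i))⁻¹

/-- The optimal weights `w_t = C_t Σ⁻¹ (μ - r_{f,t+1} 1)` as a function of `(μ, Σ)`. -/
def weights {k : ℕ} (γ W : ℝ) (rf : ℕ → ℝ) (t T : ℕ) (θ : Param k) : Fin k → ℝ :=
  portfolioConst γ W rf t T • ((θ.cov)⁻¹ *ᵥ (θ.mean - fun _ => rf (t + 1)))

/-! ### Posterior quantities -/

/-- The sample mean vector. -/
def sampleMean {k n : ℕ} (x : Fin n → Fin k → ℝ) : Fin k → ℝ :=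
  (n : ℝ)⁻¹ • ∑ i, x i

/-- The sample covariance matrix. -/
def sampleCov {k n : ℕ} (x : Fin n → Fin k → ℝ) : Matrix (Fin k) (Fin k) ℝ :=
  ((n : ℝ) - 1)⁻¹ • ∑ i, vecMulVec (x i - sampleMean x) (x i - sampleMean x)

/-- `S_{t,d}`, that is `n - 1` times the sample covariance matrix. -/
def scaleD {k n : ℕ} (x : Fin n → Fin k → ℝ) : Matrix (Fin k) (Fin k) ℝ :=
  ((n : ℝ) - 1) • sampleCov x

/-- The posterior location under the conjugate prior. -/
def meanC {k n : ℕ} (x : Fin n → Fin k → ℝ) (m₀ : Fin k → ℝ) (r₀ : ℝ) : Fin k → ℝ :=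
  ((n : ℝ) + r₀)⁻¹ • ((n : ℝ) • sampleMean x + r₀ • m₀)

/-- The posterior scale matrix `S_{t,c}` under the conjugate prior. -/
def scaleC {k n : ℕ} (x : Fin n → Fin k → ℝ) (m₀ : Fin k → ℝ) (r₀ : ℝ)
    (S₀ : Matrix (Fin k) (Fin k) ℝ) : Matrix (Fin k) (Fin k) ℝ :=
  scaleD x + S₀ +
    ((n : ℝ) * r₀ / ((n : ℝ) + r₀)) • vecMulVec (m₀ - sampleMean x) (m₀ - sampleMean x)

/-! ### Standard distributions -/

/-- The chi-square distribution with `ν` degrees of freedom. -/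
def chiSq (ν : ℝ) : Measure ℝ := gammaMeasure (ν / 2) (1 / 2)

/-- The `F`-distribution with `d₁` and `d₂` degrees of freedom, through its density. -/
def fisherF (d₁ d₂ : ℝ) : Measure ℝ :=
  volume.withDensity fun y => ENNReal.ofReal <|
    if 0 < y then
      (ProbabilityTheory.beta (d₁ / 2) (d₂ / 2))⁻¹ * (d₁ / d₂) ^ (d₁ / 2) *
        y ^ (d₁ / 2 - 1) * (1 + d₁ / d₂ * y) ^ (-(d₁ + d₂) / 2)
    else 0

/-- The unit sphere in `ℝ^k`. -/
abbrev UnitSphere (k : ℕ) : Type := Metric.sphere (0 : EuclideanSpace ℝ (Fin k)) 1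

/-- The uniform distribution on the unit sphere in `ℝ^k`: normalized surface measure. -/
def uniformSphere (k : ℕ) : Measure (UnitSphere k) :=
  ((volume : Measure (EuclideanSpace ℝ (Fin k))).toSphere Set.univ)⁻¹ •
    (volume : Measure (EuclideanSpace ℝ (Fin k))).toSphere

/-- The joint law of independent `η ∼ χ²_ν`, `z₀ ∼ N_p(0, I)`, `Q ∼ F(k, d)` and `u` uniform on
the unit sphere in `ℝ^k`. -/
def driverLaw (p k : ℕ) (ν d : ℝ) :
    Measure (ℝ × EuclideanSpace ℝ (Fin p) × ℝ × UnitSphere k) :=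
  (chiSq ν).prod ((stdGaussian (EuclideanSpace ℝ (Fin p))).prod
    ((fisherF k d).prod (uniformSphere k)))

/-! ### The functions in the representation

Here `b` is the posterior location minus `r_{f,t+1} 1`, `S` the posterior scale matrix, `N` is `n`
or `n + r₀`, and `q` stands for `k Q / d`. Square roots of matrices are the positive semidefinite
ones. -/

/-- `S^{-1/2}` for positive definite `S`. -/
def invSqrt {k : ℕ} (S : Matrix (Fin k) (Fin k) ℝ) : Matrix (Fin k) (Fin k) ℝ := (CFC.sqrt S)⁻¹

/-- The scalar `ε`. -/
def epsilonFun {k : ℕ} (b : Fin k → ℝ) (S : Matrix (Fin k) (Fin k) ℝ) (N q : ℝ)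
    (u : Fin k → ℝ) : ℝ :=
  b ⬝ᵥ (S⁻¹ *ᵥ b) + 2 / √N * (√q / (1 + q)) * (b ⬝ᵥ (invSqrt S *ᵥ u)) +
    1 / N * (q / (1 + q)) - q / (1 + q) * (b ⬝ᵥ (invSqrt S *ᵥ u)) ^ 2

/-- The vector `ζ`. -/
def zetaFun {k : ℕ} (b : Fin k → ℝ) (S : Matrix (Fin k) (Fin k) ℝ) (N q : ℝ)
    (u : Fin k → ℝ) : Fin k → ℝ :=
  S⁻¹ *ᵥ b + (1 / √N * (√q / (1 + q))) • (invSqrt S *ᵥ u) -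
    (q / (1 + q)) • ((invSqrt S * vecMulVec u u * invSqrt S) *ᵥ b)

/-- The matrix `Υ`. -/
def upsilonFun {k : ℕ} (S : Matrix (Fin k) (Fin k) ℝ) (q : ℝ) (u : Fin k → ℝ) :
    Matrix (Fin k) (Fin k) ℝ :=
  S⁻¹ - (q / (1 + q)) • (invSqrt S * vecMulVec u u * invSqrt S)

/-- `C η L ζ + C √η (ε L Υ Lᵀ - L ζ ζᵀ Lᵀ)^{1/2} z` with `ε`, `ζ`, `Υ` evaluated at `(q, u)`. -/
def representation {k p : ℕ} (C : ℝ) (L : Matrix (Fin p) (Fin k) ℝ) (b : Fin k → ℝ)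
    (S : Matrix (Fin k) (Fin k) ℝ) (N : ℝ) (η : ℝ) (z : Fin p → ℝ) (q : ℝ) (u : Fin k → ℝ) :
    Fin p → ℝ :=
  (C * η) • (L *ᵥ zetaFun b S N q u) +
    (C * √η) • (CFC.sqrt (epsilonFun b S N q u • (L * upsilonFun S q u * Lᵀ) -
      L * vecMulVec (zetaFun b S N q u) (zetaFun b S N q u) * Lᵀ) *ᵥ z)

end BayesPortfolio

end

open BayesPortfolio

noncomputable section

namespace BayesPortfolio

/-! Under either prior the posterior density is proportional to a normal inverse Wishart kernel
`|Σ|^{-(d+1)/2} exp(-tr(Σ⁻¹ A)/2)` with `A = S + N (μ-m)(μ-m)ᵀ`, where `d = n + k` for the diffuse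
prior and `d = n + d₀` for the conjugate one. The four independent drivers come from disintegrating
this kernel into `μ` and then `Σ` given `μ`.

Given `μ`, put `v = μ - ρ`, where `ρ` is the constant vector of the risk-free return. Factor `A = B
Bᵀ` so that `v` is a multiple `c` of the first column of `B`. The congruence `Σ = B M Bᵀ` reduces
the scale matrix to the identity and `Σ⁻¹ v` to `c B⁻ᵀ` applied to the first column of `M⁻¹`.
Writing `M` through the Schur complement `w⁻¹` of its lower block, that column is `(w, √w z)` with
`w ∼ χ²_{d-k}` and `z` standard normal, independent. Hence `L Σ⁻¹ v = w Lζ + √w D z` with `ζ = A⁻¹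
v`, `ε = vᵀ A⁻¹ v` and `D Dᵀ = ε L A⁻¹ Lᵀ - Lζ(Lζ)ᵀ`; a Gaussian law depends on `D` only through `D
Dᵀ`, so `D` may be replaced by the positive semidefinite square root (`factor_identity`,
`exists_lintegral_iwWeight_inv_mulVec`).

Integrating `Σ` out leaves the factor `|A|^{-(d-k)/2}`, a multivariate t kernel in `μ`. With `μ - m
= N^{-1/2} r S^{1/2} u` in polar coordinates, `|A| = |S| (1 + r²)`, so `u` is uniform and `r² =
kQ/(d-2k)` with `Q ∼ F(k, d-2k)` independent of `u` (`exists_lintegral_fisherF`). The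
Sherman–Morrison formula for the rank-one update `A` turns `A⁻¹`, `ζ`, `ε` into the stated closed
forms.

All laws are compared by integrating an arbitrary measurable `f ≥ 0`, up to a constant in `(0, ∞)`.
The case `f = 1` identifies this constant with the total mass, so no normalizing constant of the
posterior has to be matched. -/

/-! ### Coordinates on symmetric matrices -/

/-- The entries on and above the diagonal. -/
def upperPart {k : ℕ} (M : Matrix (Fin k) (Fin k) ℝ) : UpperIdx k → ℝ :=
  fun ij => M ij.1.1 ij.1.2

lemma upperPart_symMatrix {k : ℕ} (s : UpperIdx k → ℝ) : upperPart (symMatrix s) = s := by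
  ext ⟨⟨i, j⟩, h⟩
  have h' : i ≤ j := h
  simp [upperPart, symMatrix, h']

lemma symMatrix_upperPart {k : ℕ} {M : Matrix (Fin k) (Fin k) ℝ} (hM : M.IsSymm) :
    symMatrix (upperPart M) = M := by
  ext i j
  by_cases h : i ≤ j
  · simp [upperPart, symMatrix, h]
  · simp only [upperPart, symMatrix, of_apply, h, dite_false]
    exact hM.apply i j

lemma isSymm_symMatrix {k : ℕ} (s : UpperIdx k → ℝ) : (symMatrix s).IsSymm := by
  ext i j
  rcases lt_trichotomy i j with h | h | h
  · simp [symMatrix, h.le, not_le.mpr h]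
  · subst h; simp [symMatrix]
  · simp [symMatrix, h.le, not_le.mpr h]

lemma symMatrix_add {k : ℕ} (s t : UpperIdx k → ℝ) :
    symMatrix (s + t) = symMatrix s + symMatrix t := by
  ext i j
  by_cases h : i ≤ j <;> simp [symMatrix, h]

lemma symMatrix_smul {k : ℕ} (c : ℝ) (s : UpperIdx k → ℝ) :
    symMatrix (c • s) = c • symMatrix s := by
  ext i j
  by_cases h : i ≤ j <;> simp [symMatrix, h]

lemma continuous_symMatrix {k : ℕ} : Continuous (symMatrix (k := k)) := by
  refine continuous_matrix fun i j => ?_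
  by_cases h : i ≤ j <;> simp only [symMatrix, of_apply, h, dite_true, dite_false] <;> fun_prop

/-- The congruence `Σ ↦ B Σ Bᵀ` in the coordinates on and above the diagonal. -/
def congrLin {k : ℕ} (B : Matrix (Fin k) (Fin k) ℝ) :
    (UpperIdx k → ℝ) →ₗ[ℝ] (UpperIdx k → ℝ) where
  toFun s := upperPart (B * symMatrix s * Bᵀ)
  map_add' s t := by
    rw [symMatrix_add, Matrix.mul_add, Matrix.add_mul]; rfl
  map_smul' c s := by
    rw [symMatrix_smul, Matrix.mul_smul, Matrix.smul_mul]; rfl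

lemma symMatrix_congrLin {k : ℕ} (B : Matrix (Fin k) (Fin k) ℝ) (s : UpperIdx k → ℝ) :
    symMatrix (congrLin B s) = B * symMatrix s * Bᵀ := by
  have := isSymm_symMatrix s
  exact symMatrix_upperPart (M := B * symMatrix s * Bᵀ)
    (by simp only [IsSymm, transpose_mul, transpose_transpose, this.eq, Matrix.mul_assoc])

lemma congrLin_mul {k : ℕ} (B C : Matrix (Fin k) (Fin k) ℝ) :
    congrLin (B * C) = congrLin B ∘ₗ congrLin C := by
  refine LinearMap.ext fun s => ?_
  rw [LinearMap.comp_apply, ← upperPart_symMatrix (congrLin (B * C) _),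
    ← upperPart_symMatrix (congrLin B _)]
  simp only [symMatrix_congrLin, transpose_mul, Matrix.mul_assoc]

lemma congrLin_one {k : ℕ} : congrLin (1 : Matrix (Fin k) (Fin k) ℝ) = LinearMap.id := by
  refine LinearMap.ext fun s => ?_
  rw [← upperPart_symMatrix (congrLin _ _), symMatrix_congrLin]
  simp [upperPart_symMatrix]

/-- For fixed `i`, the factor `d i` arises once from each of the `k` pairs containing `i`, and once
more from the pair `(i, i)`. -/
lemma prod_upperIdx_mul {k : ℕ} (d : Fin k → ℝ) :
    ∏ ij : UpperIdx k, d ij.1.1 * d ij.1.2 = (∏ i, d i) ^ (k + 1) := by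
  have key (f : Fin k × Fin k → ℝ) :
      ∏ ij : UpperIdx k, f ij.1 = ∏ i, ∏ j, if i ≤ j then f (i, j) else 1 := by
    rw [← Finset.prod_product', Finset.univ_product_univ, ← Finset.prod_filter]
    exact (Finset.prod_subtype _ (by simp) _).symm
  rw [Finset.prod_mul_distrib, key (fun ij => d ij.1), key (fun ij => d ij.2),
    Finset.prod_comm (f := fun i j => if i ≤ j then d (i, j).2 else 1), ← Finset.prod_mul_distrib,
    ← Finset.prod_pow]
  refine Finset.prod_congr rfl fun i _ => ?_
  rw [← Finset.prod_mul_distrib]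
  have (j : Fin k) : ((if i ≤ j then d (i, j).1 else 1) * if j ≤ i then d (j, i).2 else 1) =
      d i * if i = j then d i else 1 := by
    rcases lt_trichotomy i j with h | h | h
    · simp [h.le, h.ne, not_le.mpr h]
    · simp [h]
    · simp [h.le, h.ne', not_le.mpr h]
  simp_rw [this, Finset.prod_mul_distrib]
  simp [pow_succ]

lemma det_congrLin_diagonal {k : ℕ} (d : Fin k → ℝ) :
    LinearMap.det (congrLin (diagonal d)) = (diagonal d).det ^ (k + 1) := by
  have : congrLin (diagonal d) =
      Matrix.toLin' (diagonal fun ij : UpperIdx k => d ij.1.1 * d ij.1.2) := by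
    refine LinearMap.ext fun s => ?_
    ext ⟨⟨i, j⟩, h⟩
    have h' : i ≤ j := h
    simp only [congrLin, upperPart, LinearMap.coe_mk, AddHom.coe_mk, diagonal_transpose,
      mul_diagonal, diagonal_mul, toLin'_apply, mulVec_diagonal]
    simp [symMatrix, h']
    ring
  rw [this, LinearMap.det_toLin', det_diagonal, det_diagonal, prod_upperIdx_mul]

lemma det_congrLin_mul {k : ℕ} (B C : Matrix (Fin k) (Fin k) ℝ) :
    LinearMap.det (congrLin (B * C)) =
      LinearMap.det (congrLin B) * LinearMap.det (congrLin C) := by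
  rw [congrLin_mul, LinearMap.det_comp]

/-- A transvection `τ(c)` satisfies `τ(c)² = τ(2c)`, and `τ(2c)` is conjugate to `τ(c)` by a
diagonal matrix. The determinant `δ` of its action therefore satisfies `δ² = δ`, and `δ ≠ 0` by
invertibility. -/
lemma det_congrLin_transvection {k : ℕ} {i j : Fin k} (hij : i ≠ j) (c : ℝ) :
    LinearMap.det (congrLin (transvection i j c)) = 1 := by
  have hmul : transvection i j c * transvection i j c = transvection i j (2 * c) := by
    rw [transvection_mul_transvection_same _ _ hij, two_mul]
  set D : Matrix (Fin k) (Fin k) ℝ := diagonal (Function.update 1 i 2)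
  have hconj : D * transvection i j c = transvection i j (2 * c) * D := by
    ext a b
    simp only [D, transvection, diagonal_mul, mul_diagonal, Matrix.add_apply,
      one_apply, single_apply]
    by_cases ha : a = i
    · subst ha
      by_cases hb : b = a
      · subst hb; simp [hij.symm]
      · by_cases hb' : b = j
        · subst hb'; simp [hij, hb]
        · simp [hb, Ne.symm hb, Ne.symm hb']
    · by_cases hb : a = b
      · subst hb; simp [ha, Ne.symm ha]
      · simp [hb, Ne.symm ha]
  have hD : LinearMap.det (congrLin D) ≠ 0 := by
    rw [det_congrLin_diagonal]
    refine pow_ne_zero _ ?_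
    rw [det_diagonal, Finset.prod_update_of_mem (Finset.mem_univ i)]
    simp
  have h1 := congrArg (fun M => LinearMap.det (congrLin M)) hconj
  simp only [det_congrLin_mul] at h1
  rw [← hmul, det_congrLin_mul] at h1
  have hne : LinearMap.det (congrLin (transvection i j c)) ≠ 0 := by
    have := congrArg (fun M => LinearMap.det (congrLin M))
      (transvection_mul_transvection_same _ _ hij c (-c))
    simp only [det_congrLin_mul, add_neg_cancel, transvection_zero, congrLin_one,
      LinearMap.det_id] at this
    intro h0
    simp [h0] at this
  have h2 := mul_right_cancel₀ (b := _) hD ((mul_comm _ _).trans h1)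
  exact (mul_left_cancel₀ hne (by rw [mul_one]; exact h2)).symm

/-- The Jacobian of the congruence `Σ ↦ B Σ Bᵀ` on symmetric matrices. -/
lemma det_congrLin {k : ℕ} {B : Matrix (Fin k) (Fin k) ℝ} (hB : B.det ≠ 0) :
    LinearMap.det (congrLin B) = B.det ^ (k + 1) := by
  refine diagonal_transvection_induction_of_det_ne_zero
    (fun B => LinearMap.det (congrLin B) = B.det ^ (k + 1)) B hB
    (fun D _ => det_congrLin_diagonal D) (fun t => ?_) (fun A B _ _ hA hB => ?_)
  · rw [TransvectionStruct.toMatrix, det_congrLin_transvection t.hij,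
      det_transvection_of_ne _ _ t.hij, one_pow]
  · rw [det_congrLin_mul, hA, hB, det_mul, mul_pow]

lemma lintegral_comp_congrLin {k : ℕ} {B : Matrix (Fin k) (Fin k) ℝ} (hB : B.det ≠ 0)
    {F : (UpperIdx k → ℝ) → ℝ≥0∞} (hF : Measurable F) :
    ∫⁻ s, F s = ENNReal.ofReal (|B.det| ^ (k + 1)) * ∫⁻ s, F (congrLin B s) := by
  have hdet : LinearMap.det (congrLin B) ≠ 0 := by
    rw [det_congrLin hB]; exact pow_ne_zero _ hB
  have hm : Measurable (congrLin B) :=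
    (LinearMap.continuous_of_finiteDimensional (congrLin B)).measurable
  rw [← lintegral_map hF hm, Real.map_linearMap_volume_pi_eq_smul_volume_pi hdet,
    lintegral_smul_measure, smul_eq_mul, ← mul_assoc, ← ENNReal.ofReal_mul (by positivity),
    det_congrLin hB, abs_inv, abs_pow, mul_inv_cancel₀ (by positivity), ENNReal.ofReal_one,
    one_mul]

/-! ### Measurability -/

lemma measurableSet_posDef_symMatrix {k : ℕ} :
    MeasurableSet {s : UpperIdx k → ℝ | (symMatrix s).PosDef} := by
  have : {s : UpperIdx k → ℝ | (symMatrix s).PosDef} =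
      (⋂ v : Fin k → ℝ, {s | 0 ≤ v ⬝ᵥ (symMatrix s *ᵥ v)}) ∩ {s | (symMatrix s).det ≠ 0} := by
    ext s
    simp only [Set.mem_ofPred_eq, Set.mem_inter_iff, Set.mem_iInter]
    constructor
    · intro h
      exact ⟨fun v => by simpa using h.posSemidef.dotProduct_mulVec_nonneg v, h.det_pos.ne'⟩
    · rintro ⟨h1, h2⟩
      have : (symMatrix s).PosSemidef := .of_dotProduct_mulVec_nonneg
        (isHermitian_iff_isSymm.2 (isSymm_symMatrix s)) (by simpa using h1)
      exact this.posDef_iff_det_ne_zero.2 h2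
  rw [this]
  -- The intersection over `v` is uncountable, but it consists of closed sets and so is itself
  -- closed.
  refine (IsClosed.measurableSet (isClosed_iInter fun v => ?_)).inter ?_
  · refine isClosed_le continuous_const ?_
    have := continuous_symMatrix (k := k)
    fun_prop
  · refine (isOpen_ne_fun ?_ continuous_const).measurableSet
    exact continuous_symMatrix.matrix_det

/-- The inverse is `det⁻¹` times the adjugate. With `0⁻¹ = 0` this formula also covers singular
matrices, so no invertibility is needed. -/
lemma measurable_inv_apply {α : Type*} [MeasurableSpace α] {k : ℕ}
    {M : α → Matrix (Fin k) (Fin k) ℝ} (hM : ∀ i j, Measurable fun a => M a i j) (i j : Fin k) :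
    Measurable fun a => (M a)⁻¹ i j := by
  have h1 : Continuous fun A : Fin k → Fin k → ℝ => (Matrix.of A).det :=
    Continuous.matrix_det continuous_id
  have h2 : Continuous fun A : Fin k → Fin k → ℝ => (Matrix.of A).adjugate i j :=
    (Continuous.matrix_adjugate continuous_id).matrix_elem i j
  have h3 : Measurable fun a i j => M a i j :=
    measurable_pi_lambda _ fun i => measurable_pi_lambda _ fun j => hM i j
  simp only [inv_def, Matrix.smul_apply, Ring.inverse_eq_inv', smul_eq_mul]
  exact (h1.measurable.comp h3).inv.mul (h2.measurable.comp h3)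

lemma measurable_det_apply {α : Type*} [MeasurableSpace α] {k : ℕ}
    {M : α → Matrix (Fin k) (Fin k) ℝ} (hM : ∀ i j, Measurable fun a => M a i j) :
    Measurable fun a => (M a).det := by
  have h1 : Continuous fun A : Fin k → Fin k → ℝ => (Matrix.of A).det :=
    Continuous.matrix_det continuous_id
  have h3 : Measurable fun a i j => M a i j :=
    measurable_pi_lambda _ fun i => measurable_pi_lambda _ fun j => hM i j
  exact h1.measurable.comp h3

section Sqrt
open scoped Matrix.Norms.L2Operator NNReal

lemma continuousOn_sqrt {p : ℕ} :
    ContinuousOn (CFC.sqrt : Matrix (Fin p) (Fin p) ℝ → Matrix (Fin p) (Fin p) ℝ)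
      {M | 0 ≤ M} :=
  ContinuousOn.cfcₙ_nnreal_of_mem_nhdsSet (s := Set.univ) NNReal.sqrt Filter.univ_mem
    continuousOn_id (fun _ h => h) (by fun_prop) (by simp)

end Sqrt

lemma measurable_sqrt_apply {α : Type*} [MeasurableSpace α] {p : ℕ}
    {M : α → Matrix (Fin p) (Fin p) ℝ} (hM : ∀ i j, Measurable fun a => M a i j) (i j : Fin p) :
    Measurable fun a => CFC.sqrt (M a) i j := by
  have h3 : Measurable fun a i j => M a i j :=
    measurable_pi_lambda _ fun i => measurable_pi_lambda _ fun j => hM i j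
  have hcl : IsClosed {A : Fin p → Fin p → ℝ | (0 : Matrix (Fin p) (Fin p) ℝ) ≤ Matrix.of A} := by
    have : {A : Fin p → Fin p → ℝ | (0 : Matrix (Fin p) (Fin p) ℝ) ≤ Matrix.of A} =
        {A | (Matrix.of A)ᵀ = Matrix.of A} ∩
          ⋂ v : Fin p → ℝ, {A | 0 ≤ v ⬝ᵥ (Matrix.of A *ᵥ v)} := by
      ext A
      simp only [nonneg_iff_posSemidef, posSemidef_iff_dotProduct_mulVec, isHermitian_iff_isSymm]
      simp [IsSymm]
    rw [this]
    refine (isClosed_eq ?_ continuous_id).inter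
      (isClosed_iInter fun v => isClosed_le continuous_const ?_)
    · exact Continuous.matrix_transpose continuous_id
    · exact Continuous.dotProduct continuous_const
        (Continuous.matrix_mulVec continuous_id continuous_const)
  have h4 : Measurable fun A : Fin p → Fin p → ℝ => CFC.sqrt (Matrix.of A) i j := by
    have hc : ContinuousOn (fun A : Fin p → Fin p → ℝ => CFC.sqrt (Matrix.of A) i j)
        {A | (0 : Matrix (Fin p) (Fin p) ℝ) ≤ Matrix.of A} :=
      (continuous_id.matrix_elem i j).comp_continuousOn continuousOn_sqrt
    refine measurable_of_restrict_of_restrict_compl hcl.measurableSet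
      hc.domRestrict.measurable ?_
    -- Off the positive semidefinite cone `CFC.sqrt` takes its default value `0`; measurability on
    -- the whole space is glued from the two pieces.
    convert measurable_const (a := (0 : ℝ)) using 1
    ext ⟨A, hA⟩
    have hA' : ¬ (0 : Matrix (Fin p) (Fin p) ℝ) ≤ Matrix.of A := hA
    change CFC.sqrt (Matrix.of A) i j = 0
    rw [CFC.sqrt_of_not_nonneg hA', Matrix.zero_apply]
  exact h4.comp h3

/-! ### Bordered matrices -/

/-- The matrix with first row `(a, g)`, first column `(a, g)` and lower right block `M`. -/
def bordered {k : ℕ} (a : ℝ) (g : Fin k → ℝ) (M : Matrix (Fin k) (Fin k) ℝ) :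
    Matrix (Fin (k + 1)) (Fin (k + 1)) ℝ :=
  Matrix.of (Fin.cons (Fin.cons a g : Fin (k + 1) → ℝ)
    (fun i => (Fin.cons (g i) (M i) : Fin (k + 1) → ℝ)) : Fin (k + 1) → Fin (k + 1) → ℝ)

section
variable {k : ℕ} (a : ℝ) (g : Fin k → ℝ) (M : Matrix (Fin k) (Fin k) ℝ)

@[simp] lemma bordered_zero_zero : bordered a g M 0 0 = a := rfl
@[simp] lemma bordered_zero_succ (j : Fin k) : bordered a g M 0 j.succ = g j := rfl
@[simp] lemma bordered_succ_zero (i : Fin k) : bordered a g M i.succ 0 = g i := rfl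
@[simp] lemma bordered_succ_succ (i j : Fin k) : bordered a g M i.succ j.succ = M i j := rfl

lemma bordered_mulVec_cons (x : ℝ) (y : Fin k → ℝ) :
    bordered a g M *ᵥ (Fin.cons x y : Fin (k + 1) → ℝ) =
      Fin.cons (a * x + g ⬝ᵥ y) (x • g + M *ᵥ y) := by
  ext i
  refine Fin.cases ?_ (fun i => ?_) i
  · simp [mulVec, dotProduct, Fin.sum_univ_succ]
  · simp [mulVec, dotProduct, Fin.sum_univ_succ, mul_comm]

lemma cons_dotProduct_cons (x : ℝ) (y : Fin k → ℝ) (x' : ℝ) (y' : Fin k → ℝ) :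
    (Fin.cons x y : Fin (k + 1) → ℝ) ⬝ᵥ (Fin.cons x' y' : Fin (k + 1) → ℝ) =
      x * x' + y ⬝ᵥ y' := by
  simp [dotProduct, Fin.sum_univ_succ]

lemma trace_bordered : (bordered a g M).trace = a + M.trace := by
  simp [trace, Fin.sum_univ_succ]

variable {M}

lemma isSymm_bordered (hM : M.IsSymm) : (bordered a g M).IsSymm := by
  ext i j
  refine Fin.cases ?_ (fun i => ?_) i <;> refine Fin.cases ?_ (fun j => ?_) j <;> simp
  exact hM.apply i j

/-- Block inversion with Schur complement `w⁻¹`. Writing the border as `M *ᵥ g` makes the first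
column of the inverse simply `(w, -w g)`. The identity is checked on vectors `(x, y)`. -/
lemma bordered_mul_inverse (hM : M.IsSymm) (hdet : IsUnit M.det) {w : ℝ} (hw : w ≠ 0) :
    bordered (w⁻¹ + g ⬝ᵥ (M *ᵥ g)) (M *ᵥ g) M *
      bordered w (-(w • g)) (M⁻¹ + w • vecMulVec g g) = 1 := by
  refine Matrix.ext_of_mulVec_single fun j => ?_
  rw [← mulVec_mulVec]
  have hcol : ∀ y : Fin k → ℝ, vecMulVec g g *ᵥ y = (g ⬝ᵥ y) • g := fun y => by
    rw [vecMulVec_mulVec]; simp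
  have h1 : ∀ x y, bordered (w⁻¹ + g ⬝ᵥ (M *ᵥ g)) (M *ᵥ g) M *ᵥ
      (bordered w (-(w • g)) (M⁻¹ + w • vecMulVec g g) *ᵥ (Fin.cons x y : Fin (k + 1) → ℝ)) =
      (Fin.cons x y : Fin (k + 1) → ℝ) := by
    intro x y
    have e1 : (M *ᵥ g) ⬝ᵥ (M⁻¹ *ᵥ y) = g ⬝ᵥ y := by
      rw [dotProduct_mulVec, ← mulVec_transpose, transpose_nonsing_inv, hM.eq, mulVec_mulVec,
        nonsing_inv_mul _ hdet, one_mulVec]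
    have e2 : M *ᵥ (M⁻¹ *ᵥ y) = y := by
      rw [mulVec_mulVec, mul_nonsing_inv _ hdet, one_mulVec]
    rw [bordered_mulVec_cons, bordered_mulVec_cons]
    simp only [add_mulVec, smul_mulVec, hcol, mulVec_add, mulVec_smul, mulVec_neg, e2,
      dotProduct_add, dotProduct_smul, dotProduct_neg, neg_dotProduct, smul_dotProduct, e1,
      smul_neg, smul_eq_mul]
    congr 1
    · rw [dotProduct_comm (M *ᵥ g) g]
      field_simp
      ring
    · ext i
      simp
      ring
  rw [one_mulVec]
  have := h1 ((Pi.single j (1 : ℝ) : Fin (k + 1) → ℝ) 0)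
    (Fin.tail (Pi.single j (1 : ℝ) : Fin (k + 1) → ℝ))
  rwa [Fin.cons_self_tail] at this

lemma inv_bordered (hM : M.IsSymm) (hdet : IsUnit M.det) {w : ℝ} (hw : w ≠ 0) :
    (bordered (w⁻¹ + g ⬝ᵥ (M *ᵥ g)) (M *ᵥ g) M)⁻¹ =
      bordered w (-(w • g)) (M⁻¹ + w • vecMulVec g g) :=
  inv_eq_right_inv (bordered_mul_inverse g hM hdet hw)

lemma bordered_mulVec_zero : bordered a g M *ᵥ Pi.single 0 1 = Fin.cons a g := by
  ext i
  refine Fin.cases ?_ (fun i => ?_) i <;> simp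

/-- Block elimination: the matrix is `U D` with `U` unit upper triangular carrying `g`, and `D`
block lower triangular with diagonal blocks `c` and `M`. -/
lemma det_bordered (hM : M.IsSymm) (c : ℝ) :
    (bordered (c + g ⬝ᵥ (M *ᵥ g)) (M *ᵥ g) M).det = c * M.det := by
  set U : Matrix (Fin (k + 1)) (Fin (k + 1)) ℝ :=
    Matrix.of (Fin.cons (Fin.cons 1 g : Fin (k + 1) → ℝ)
      (fun i => (Fin.cons 0 ((1 : Matrix (Fin k) (Fin k) ℝ) i) : Fin (k + 1) → ℝ)) :
        Fin (k + 1) → Fin (k + 1) → ℝ)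
  set D : Matrix (Fin (k + 1)) (Fin (k + 1)) ℝ :=
    Matrix.of (Fin.cons (Fin.cons c 0 : Fin (k + 1) → ℝ)
      (fun i => (Fin.cons ((M *ᵥ g) i) (M i) : Fin (k + 1) → ℝ)) :
        Fin (k + 1) → Fin (k + 1) → ℝ)
  have hUD : bordered (c + g ⬝ᵥ (M *ᵥ g)) (M *ᵥ g) M = U * D := by
    ext i j
    refine Fin.cases ?_ (fun i => ?_) i <;> refine Fin.cases ?_ (fun j => ?_) j
    · simp [U, D, mul_apply, Fin.sum_univ_succ, dotProduct]
    · simp only [bordered_zero_succ, U, D, mul_apply, Fin.sum_univ_succ, of_apply, Fin.cons_zero,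
        Fin.cons_succ, mulVec, dotProduct, Pi.zero_apply, mul_zero, zero_add]
      exact Finset.sum_congr rfl fun i _ => by rw [hM.apply i j, mul_comm]
    · simp [U, D, mul_apply, Fin.sum_univ_succ, one_apply]
    · simp [U, D, mul_apply, Fin.sum_univ_succ, one_apply]
  have hU : U.det = 1 := by
    rw [det_succ_column_zero, Fin.sum_univ_succ]
    have : U.submatrix (Fin.succAbove 0) Fin.succ = 1 := by
      ext i j; simp [U]
    simp [U] at this ⊢
    rw [this, det_one]
  have hD : D.det = c * M.det := by
    rw [det_succ_row_zero, Fin.sum_univ_succ]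
    have : D.submatrix Fin.succ (Fin.succAbove 0) = M := by
      ext i j; simp [D]
    simp [D] at this ⊢
    exact Or.inl (congrArg det this)
  rw [hUD, det_mul, hU, hD, one_mul]

lemma posDef_of_bordered (h : (bordered a g M).PosDef) : M.PosDef := by
  have := h.submatrix (Fin.succ_injective k)
  exact this

/-- Completing the square, the quadratic form at `(x, y)` is `c x² + (x g + y)ᵀ M (x g + y)`;
conversely the determinant `c |M|` must be positive. -/
lemma posDef_bordered_iff (hM : M.PosDef) (c : ℝ) :
    (bordered (c + g ⬝ᵥ (M *ᵥ g)) (M *ᵥ g) M).PosDef ↔ 0 < c := by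
  have hsym : M.IsSymm := isHermitian_iff_isSymm.1 hM.1
  constructor
  · intro h
    have h1 := h.det_pos
    rw [det_bordered g hsym] at h1
    exact (pos_iff_pos_of_mul_pos h1).2 hM.det_pos
  · intro hc
    refine .of_dotProduct_mulVec_pos (isHermitian_iff_isSymm.2 (isSymm_bordered _ _ hsym)) ?_
    intro v hv
    obtain ⟨x, y, rfl⟩ : ∃ x y, v = (Fin.cons x y : Fin (k + 1) → ℝ) :=
      ⟨v 0, Fin.tail v, (Fin.cons_self_tail v).symm⟩
    have e : y ⬝ᵥ (M *ᵥ g) = (M *ᵥ g) ⬝ᵥ y := dotProduct_comm _ _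
    have e2 : g ⬝ᵥ (M *ᵥ y) = (M *ᵥ g) ⬝ᵥ y := by
      rw [dotProduct_mulVec, ← mulVec_transpose, hsym.eq]
    have key : (Fin.cons x y : Fin (k + 1) → ℝ) ⬝ᵥ
        (bordered (c + g ⬝ᵥ (M *ᵥ g)) (M *ᵥ g) M *ᵥ (Fin.cons x y : Fin (k + 1) → ℝ)) =
        c * x ^ 2 + (x • g + y) ⬝ᵥ (M *ᵥ (x • g + y)) := by
      rw [bordered_mulVec_cons, cons_dotProduct_cons]
      simp only [mulVec_add, mulVec_smul, dotProduct_add, dotProduct_smul, add_dotProduct,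
        smul_dotProduct, smul_eq_mul, e, e2]
      ring
    rw [star_trivial, key]
    by_cases hx : x = 0
    · have hy : y ≠ 0 := by
        rintro rfl
        apply hv
        subst hx
        ext i
        refine Fin.cases ?_ (fun i => ?_) i <;> simp
      have := hM.dotProduct_mulVec_pos hy
      simpa [hx] using this
    · have h1 := hM.posSemidef.dotProduct_mulVec_nonneg (x • g + y)
      rw [star_trivial] at h1
      have : 0 < c * x ^ 2 := by positivity
      linarith

end

/-- The coordinates of `bordered a g (symMatrix t)`. -/
def borderCoord {k : ℕ} (a : ℝ) (g : Fin k → ℝ) (t : UpperIdx k → ℝ) : UpperIdx (k + 1) → ℝ :=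
  upperPart (bordered a g (symMatrix t))

lemma symMatrix_borderCoord {k : ℕ} (a : ℝ) (g : Fin k → ℝ) (t : UpperIdx k → ℝ) :
    symMatrix (borderCoord a g t) = bordered a g (symMatrix t) :=
  symMatrix_upperPart (isSymm_bordered _ _ (isSymm_symMatrix t))

/-- The first row and the other positions on and above the diagonal. -/
def upperIdxOfSum (k : ℕ) : Fin (k + 1) ⊕ UpperIdx k → UpperIdx (k + 1) :=
  Sum.elim (fun j => ⟨(0, j), Fin.zero_le j⟩)
    (fun ij => ⟨(ij.1.1.succ, ij.1.2.succ), Fin.succ_le_succ_iff.2 ij.2⟩)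

lemma bijective_upperIdxOfSum (k : ℕ) : Function.Bijective (upperIdxOfSum k) := by
  constructor
  · rintro (j | ⟨⟨i, j⟩, h⟩) (j' | ⟨⟨i', j'⟩, h'⟩) <;>
      simp [upperIdxOfSum, Fin.succ_ne_zero, eq_comm]
  · rintro ⟨⟨i, j⟩, h⟩
    have h0 : i ≤ j := h
    induction i using Fin.cases with
    | zero => exact ⟨.inl j, rfl⟩
    | succ i =>
      induction j using Fin.cases with
      | zero => exact absurd (Fin.le_zero_iff.1 h0) (Fin.succ_ne_zero i)
      | succ j => exact ⟨.inr ⟨(i, j), Fin.succ_le_succ_iff.1 h0⟩, rfl⟩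

/-- `upperIdxOfSum` as an equivalence. -/
def upperIdxEquiv (k : ℕ) : Fin (k + 1) ⊕ UpperIdx k ≃ UpperIdx (k + 1) :=
  Equiv.ofBijective _ (bijective_upperIdxOfSum k)

/-- Corner, border and block are a relabelling of the coordinates, so this is Tonelli without a
Jacobian. -/
lemma lintegral_borderCoord {k : ℕ} {F : (UpperIdx (k + 1) → ℝ) → ℝ≥0∞} (hF : Measurable F) :
    ∫⁻ s, F s = ∫⁻ t : UpperIdx k → ℝ, ∫⁻ g : Fin k → ℝ, ∫⁻ a : ℝ, F (borderCoord a g t) := by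
  have e1 := (volume_measurePreserving_piCongrLeft (fun _ => ℝ) (upperIdxEquiv k))
  have e2 := (volume_measurePreserving_sumPiEquivProdPi_symm
    (fun _ : Fin (k + 1) ⊕ UpperIdx k => ℝ))
  have e3 := (volume_preserving_piFinSuccAbove (fun _ : Fin (k + 1) => ℝ) 0).symm
  have hb : ∀ a g t, MeasurableEquiv.piCongrLeft (fun _ => ℝ) (upperIdxEquiv k)
      ((MeasurableEquiv.sumPiEquivProdPi (fun _ : Fin (k + 1) ⊕ UpperIdx k => ℝ)).symm
        ((MeasurableEquiv.piFinSuccAbove (fun _ : Fin (k + 1) => ℝ) 0).symm (a, g), t)) =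
      borderCoord a g t := by
    intro a g t
    ext ij
    obtain ⟨y, rfl⟩ := (upperIdxEquiv k).surjective ij
    rw [MeasurableEquiv.coe_piCongrLeft]
    erw [Equiv.piCongrLeft_apply_apply]
    rcases y with j | ⟨⟨i, j⟩, h⟩
    · change (Fin.insertNth 0 a g : Fin (k + 1) → ℝ) j = bordered a g (symMatrix t) 0 j
      induction j using Fin.cases with
      | zero => rfl
      | succ j => rfl
    · exact (congrFun (upperPart_symMatrix t) ⟨(i, j), h⟩).symm
  rw [← e1.lintegral_comp hF, ← e2.lintegral_comp (hF.fun_comp e1.measurable),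
    Measure.volume_eq_prod,
    lintegral_prod_symm _ (hF.fun_comp (e1.measurable.fun_comp e2.measurable)).aemeasurable]
  refine lintegral_congr fun t => ?_
  have hm : Measurable fun x : Fin (k + 1) → ℝ => F (MeasurableEquiv.piCongrLeft (fun _ => ℝ)
      (upperIdxEquiv k) ((MeasurableEquiv.sumPiEquivProdPi
        (fun _ : Fin (k + 1) ⊕ UpperIdx k => ℝ)).symm (x, t))) :=
    hF.comp (e1.measurable.comp (e2.measurable.comp (by fun_prop)))
  rw [← e3.lintegral_comp hm, Measure.volume_eq_prod,
    lintegral_prod_symm _ (hm.fun_comp e3.measurable).aemeasurable]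
  simp only [hb]

/-! ### Unnormalized inverse Wishart weights -/

open Classical in
/-- The weight `|M|^{-(d+1)/2} exp(-tr(M⁻¹ A)/2)` on positive definite matrices,
and `0` elsewhere. -/
def iwWeight {k : ℕ} (d : ℝ) (A M : Matrix (Fin k) (Fin k) ℝ) : ℝ≥0∞ :=
  if M.PosDef then ENNReal.ofReal (M.det ^ (-(d + 1) / 2) * Real.exp (-(M⁻¹ * A).trace / 2)) else 0

lemma iwWeight_of_posDef {k : ℕ} {M : Matrix (Fin k) (Fin k) ℝ} (hM : M.PosDef) (d : ℝ)
    (A : Matrix (Fin k) (Fin k) ℝ) : iwWeight d A M =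
      ENNReal.ofReal (M.det ^ (-(d + 1) / 2) * Real.exp (-(M⁻¹ * A).trace / 2)) := if_pos hM

lemma iwWeight_of_not_posDef {k : ℕ} {M : Matrix (Fin k) (Fin k) ℝ} (hM : ¬ M.PosDef) (d : ℝ)
    (A : Matrix (Fin k) (Fin k) ℝ) : iwWeight d A M = 0 := if_neg hM

lemma measurable_symMatrix_apply {k : ℕ} (i j : Fin k) :
    Measurable fun s : UpperIdx k → ℝ => symMatrix s i j :=
  (continuous_symMatrix.matrix_elem i j).measurable

lemma measurable_mulVec {α : Type*} [MeasurableSpace α] {m n : ℕ}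
    {M : α → Matrix (Fin m) (Fin n) ℝ} (hM : ∀ i j, Measurable fun a => M a i j)
    {v : α → Fin n → ℝ} (hv : Measurable v) : Measurable fun a => M a *ᵥ v a := by
  refine measurable_pi_lambda _ fun i => ?_
  simp only [mulVec, dotProduct]
  exact Finset.measurable_sum _ fun j _ => (hM i j).mul ((measurable_pi_apply j).comp hv)

lemma measurable_dotProduct {α : Type*} [MeasurableSpace α] {n : ℕ}
    {v w : α → Fin n → ℝ} (hv : Measurable v) (hw : Measurable w) :
    Measurable fun a => v a ⬝ᵥ w a := by
  simp only [dotProduct]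
  exact Finset.measurable_sum _ fun j _ =>
    ((measurable_pi_apply j).comp hv).mul ((measurable_pi_apply j).comp hw)

lemma measurable_mul_apply {α : Type*} [MeasurableSpace α] {l m n : ℕ}
    {M : α → Matrix (Fin l) (Fin m) ℝ} (hM : ∀ i j, Measurable fun a => M a i j)
    {N : α → Matrix (Fin m) (Fin n) ℝ} (hN : ∀ i j, Measurable fun a => N a i j) (i : Fin l)
    (j : Fin n) : Measurable fun a => (M a * N a) i j := by
  simp only [mul_apply]
  exact Finset.measurable_sum _ fun a _ => (hM i a).mul (hN a j)

lemma measurable_iwWeight_comp {α : Type*} [MeasurableSpace α] {k : ℕ} (d : ℝ)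
    {A : α → Matrix (Fin k) (Fin k) ℝ} (hA : ∀ i j, Measurable fun a => A a i j)
    {s : α → UpperIdx k → ℝ} (hs : Measurable s) :
    Measurable fun a => iwWeight d (A a) (symMatrix (s a)) := by
  have hS (i j : Fin k) : Measurable fun a => symMatrix (s a) i j :=
    (measurable_symMatrix_apply i j).comp hs
  refine Measurable.ite (hs measurableSet_posDef_symMatrix) ?_ measurable_const
  refine ENNReal.measurable_ofReal.comp (Measurable.mul ?_ ?_)
  · exact (measurable_det_apply hS).pow_const _
  · refine Real.measurable_exp.comp (Measurable.div_const (Measurable.neg ?_) _)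
    simp only [trace, diag]
    exact Finset.measurable_sum _ fun i _ => measurable_mul_apply (measurable_inv_apply hS) hA i i

lemma measurable_iwWeight {k : ℕ} (d : ℝ) (A : Matrix (Fin k) (Fin k) ℝ) :
    Measurable fun s : UpperIdx k → ℝ => iwWeight d A (symMatrix s) :=
  measurable_iwWeight_comp d (A := fun _ => A) (s := fun s => s)
    (fun _ _ => measurable_const) measurable_id

/-- The determinant is `w⁻¹ |M|` and the trace of the inverse is `w + tr M⁻¹ + w |g|²`. The weight
thus splits into a function of `(w, g)` and the weight of the block, which separates the first
column of the inverse from `M`. -/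
lemma iwWeight_bordered {k : ℕ} {M : Matrix (Fin k) (Fin k) ℝ} (hM : M.PosDef) (d : ℝ)
    {w : ℝ} (hw : 0 < w) (g : Fin k → ℝ) :
    iwWeight d 1 (bordered (w⁻¹ + g ⬝ᵥ (M *ᵥ g)) (M *ᵥ g) M) =
      ENNReal.ofReal (w ^ ((d + 1) / 2) * Real.exp (-w / 2) * Real.exp (-(w * (g ⬝ᵥ g)) / 2)) *
        iwWeight d 1 M := by
  have hsym : M.IsSymm := isHermitian_iff_isSymm.1 hM.1
  rw [iwWeight_of_posDef ((posDef_bordered_iff g hM _).2 (inv_pos.2 hw)), iwWeight_of_posDef hM,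
    ← ENNReal.ofReal_mul (by positivity), mul_one, mul_one,
    inv_bordered g hsym hM.det_pos.ne'.isUnit hw.ne', trace_bordered, trace_add, trace_smul,
    trace_vecMulVec, det_bordered g hsym, Real.mul_rpow (by positivity) hM.det_pos.le,
    Real.inv_rpow hw.le, ← Real.rpow_neg hw.le, smul_eq_mul]
  congr 1
  have : Real.exp (-(w + (M⁻¹.trace + w * (g ⬝ᵥ g))) / 2) =
      Real.exp (-w / 2) * Real.exp (-(w * (g ⬝ᵥ g)) / 2) * Real.exp (-M⁻¹.trace / 2) := by
    rw [← Real.exp_add, ← Real.exp_add]; congr 1; ring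
  rw [this]
  ring_nf

/-- Absorbs the Jacobian of `g ↦ M g`: one more power of `|M|` lowers `d` by two. -/
lemma ofReal_det_mul_iwWeight {k : ℕ} {M : Matrix (Fin k) (Fin k) ℝ} (hM : M.PosDef) (d : ℝ)
    (A : Matrix (Fin k) (Fin k) ℝ) :
    ENNReal.ofReal |M.det| * iwWeight d A M = iwWeight (d - 2) A M := by
  rw [iwWeight_of_posDef hM, iwWeight_of_posDef hM, ← ENNReal.ofReal_mul (by positivity),
    abs_of_pos hM.det_pos, ← mul_assoc]
  nth_rw 1 [← Real.rpow_one M.det]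
  rw [← Real.rpow_add hM.det_pos]
  ring_nf

lemma lintegral_comp_mulVec {k : ℕ} {M : Matrix (Fin k) (Fin k) ℝ} (hM : M.det ≠ 0)
    {F : (Fin k → ℝ) → ℝ≥0∞} (hF : Measurable F) :
    ∫⁻ s, F s = ENNReal.ofReal |M.det| * ∫⁻ g, F (M *ᵥ g) := by
  have hm : Measurable (Matrix.toLin' M) :=
    (LinearMap.continuous_of_finiteDimensional (Matrix.toLin' M)).measurable
  have : ∫⁻ g, F (M *ᵥ g) = ∫⁻ g, F (Matrix.toLin' M g) := rfl
  rw [this, ← lintegral_map hF hm, Real.map_matrix_volume_pi_eq_smul_volume_pi hM,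
    lintegral_smul_measure, smul_eq_mul, ← mul_assoc, ← ENNReal.ofReal_mul (by positivity),
    abs_inv, mul_inv_cancel₀ (by positivity), ENNReal.ofReal_one, one_mul]

lemma lintegral_comp_smul_pi {k : ℕ} {c : ℝ} (hc : c ≠ 0) {F : (Fin k → ℝ) → ℝ≥0∞}
    (hF : Measurable F) : ∫⁻ s, F s = ENNReal.ofReal (|c| ^ k) * ∫⁻ g, F (c • g) := by
  have hdet : (c • (1 : Matrix (Fin k) (Fin k) ℝ)).det = c ^ k := by simp
  rw [lintegral_comp_mulVec (M := c • 1) (by rw [hdet]; exact pow_ne_zero _ hc) hF, hdet, abs_pow]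
  simp [smul_mulVec]

lemma lintegral_Ioi_inv (G : ℝ → ℝ≥0∞) :
    ∫⁻ a in Set.Ioi 0, G a = ∫⁻ w in Set.Ioi 0, ENNReal.ofReal (w ^ (-2 : ℝ)) * G w⁻¹ := by
  have him : (fun w : ℝ => w⁻¹) '' Set.Ioi 0 = Set.Ioi 0 := by
    ext y
    simp only [Set.mem_image, Set.mem_Ioi]
    exact ⟨fun ⟨x, hx, h⟩ => h ▸ inv_pos.2 hx, fun h => ⟨y⁻¹, inv_pos.2 h, inv_inv y⟩⟩
  have h := lintegral_image_eq_lintegral_abs_deriv_mul (f := fun w : ℝ => w⁻¹)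
    (f' := fun w => -(w ^ 2)⁻¹) (s := Set.Ioi 0) measurableSet_Ioi
    (fun x hx => (hasDerivAt_inv (ne_of_gt hx)).hasDerivWithinAt)
    (fun x _ y _ h => inv_injective h) G
  rw [him] at h
  rw [h]
  refine setLIntegral_congr_fun measurableSet_Ioi fun w hw => ?_
  have hw' : (0 : ℝ) < w := hw
  simp only [abs_neg, abs_inv, abs_pow, abs_of_pos hw']
  rw [Real.rpow_neg hw'.le]
  norm_num

lemma measurable_borderCoord {k : ℕ} (t : UpperIdx k → ℝ) :
    Measurable fun p : ℝ × (Fin k → ℝ) => borderCoord p.1 p.2 t := by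
  refine measurable_pi_lambda _ fun ⟨⟨i, j⟩, h⟩ => ?_
  simp only [borderCoord, upperPart]
  clear h
  induction i using Fin.cases with
  | zero => induction j using Fin.cases with
    | zero => exact measurable_fst
    | succ j => exact (measurable_pi_apply j).comp measurable_snd
  | succ i => induction j using Fin.cases with
    | zero => exact (measurable_pi_apply i).comp measurable_snd
    | succ j => exact measurable_const

lemma measurable_cons {α : Type*} [MeasurableSpace α] {k : ℕ} {w : α → ℝ} (hw : Measurable w)
    {z : α → Fin k → ℝ} (hz : Measurable z) :
    Measurable fun a => (Fin.cons (w a) (z a) : Fin (k + 1) → ℝ) := by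
  refine measurable_pi_lambda _ fun i => ?_
  induction i using Fin.cases with
  | zero => exact hw
  | succ i => exact (measurable_pi_apply i).comp hz

/-- The first column of the inverse matrix under the weight `iwWeight d 1`. -/
lemma lintegral_iwWeight_one_inv_col {k : ℕ} (d : ℝ) {F : (Fin (k + 1) → ℝ) → ℝ≥0∞}
    (hF : Measurable F) :
    ∫⁻ s : UpperIdx (k + 1) → ℝ,
        iwWeight d 1 (symMatrix s) * F ((symMatrix s)⁻¹ *ᵥ Pi.single 0 1) =
      (∫⁻ t : UpperIdx k → ℝ, iwWeight (d - 2) 1 (symMatrix t)) *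
        ∫⁻ w in Set.Ioi (0 : ℝ),
          ENNReal.ofReal (w ^ ((d - (k + 1 : ℕ)) / 2 - 1) * Real.exp (-w / 2)) *
            ∫⁻ z : Fin k → ℝ, ENNReal.ofReal (Real.exp (-(z ⬝ᵥ z) / 2)) *
              F (Fin.cons w (√w • z)) := by
  have hG : Measurable fun s : UpperIdx (k + 1) → ℝ =>
      iwWeight d 1 (symMatrix s) * F ((symMatrix s)⁻¹ *ᵥ Pi.single 0 1) :=
    (measurable_iwWeight d 1).mul (hF.comp (measurable_mulVec
      (measurable_inv_apply measurable_symMatrix_apply) measurable_const))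
  rw [lintegral_borderCoord hG, ← lintegral_mul_const _ (measurable_iwWeight _ _)]
  refine lintegral_congr fun t => ?_
  set M := symMatrix t with hMdef
  by_cases hM : M.PosDef
  swap
  · rw [iwWeight_of_not_posDef hM, zero_mul]
    simp only [symMatrix_borderCoord]
    have (a : ℝ) (g : Fin k → ℝ) : iwWeight d 1 (bordered a g M) = 0 :=
      iwWeight_of_not_posDef (fun h => hM (posDef_of_bordered a g h)) _ _
    simp [← hMdef, this]
  have hsym : M.IsSymm := isHermitian_iff_isSymm.1 hM.1
  set G : ℝ → (Fin k → ℝ) → ℝ≥0∞ := fun a g =>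
    iwWeight d 1 (symMatrix (borderCoord a g t)) *
      F ((symMatrix (borderCoord a g t))⁻¹ *ᵥ Pi.single 0 1) with hGdef
  have hGm : Measurable fun p : ℝ × (Fin k → ℝ) => G p.1 p.2 :=
    hG.comp (measurable_borderCoord t)
  have hGneg (a : ℝ) (g : Fin k → ℝ) (ha : a ≤ 0) : G (a + g ⬝ᵥ (M *ᵥ g)) (M *ᵥ g) = 0 := by
    simp only [hGdef, symMatrix_borderCoord]
    rw [iwWeight_of_not_posDef (fun h => not_lt.2 ha ((posDef_bordered_iff g hM a).1 h)), zero_mul]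
  have hGpos (w : ℝ) (g : Fin k → ℝ) (hw : 0 < w) : G (w⁻¹ + g ⬝ᵥ (M *ᵥ g)) (M *ᵥ g) =
      ENNReal.ofReal (w ^ ((d + 1) / 2) * Real.exp (-w / 2) * Real.exp (-(w * (g ⬝ᵥ g)) / 2)) *
        iwWeight d 1 M * F (Fin.cons w (-(w • g))) := by
    simp only [hGdef, symMatrix_borderCoord]
    rw [iwWeight_bordered hM d hw, inv_bordered g hsym hM.det_pos.ne'.isUnit hw.ne',
      bordered_mulVec_zero]
  set H : ℝ → (Fin k → ℝ) → ℝ≥0∞ := fun w g => ENNReal.ofReal (w ^ (-2 : ℝ)) *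
      (ENNReal.ofReal (w ^ ((d + 1) / 2) * Real.exp (-w / 2) * Real.exp (-(w * (g ⬝ᵥ g)) / 2)) *
        iwWeight d 1 M * F (Fin.cons w (-(w • g)))) with hHdef
  have hHm : Measurable fun p : ℝ × (Fin k → ℝ) => H p.1 p.2 := by
    have h1 : Measurable fun p : ℝ × (Fin k → ℝ) => p.2 ⬝ᵥ p.2 :=
      measurable_dotProduct measurable_snd measurable_snd
    have h2 : Measurable fun p : ℝ × (Fin k → ℝ) =>
        F (Fin.cons p.1 (-(p.1 • p.2))) :=
      hF.comp (measurable_cons measurable_fst (measurable_fst.smul measurable_snd).neg)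
    simp only [hHdef]
    fun_prop
  -- Translating the corner by `gᵀ M g` makes the Schur complement the variable of integration. Only
  -- positive values contribute, and its inverse `w` is the corner of the inverse matrix.
  have step (g : Fin k → ℝ) : ∫⁻ a, G a (M *ᵥ g) = ∫⁻ w in Set.Ioi 0, H w g := by
    rw [← lintegral_add_right_eq_self (fun a => G a (M *ᵥ g)) (g ⬝ᵥ (M *ᵥ g)),
      show ∫⁻ a, G (a + g ⬝ᵥ (M *ᵥ g)) (M *ᵥ g) =
        ∫⁻ a in Set.Ioi 0, G (a + g ⬝ᵥ (M *ᵥ g)) (M *ᵥ g) by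
          rw [← lintegral_indicator measurableSet_Ioi]
          refine lintegral_congr fun a => ?_
          by_cases ha : 0 < a
          · rw [Set.indicator_of_mem (Set.mem_Ioi.2 ha)]
          · rw [Set.indicator_of_notMem (by simpa using ha), hGneg a g (not_lt.1 ha)],
      lintegral_Ioi_inv]
    refine setLIntegral_congr_fun measurableSet_Ioi fun w hw => ?_
    simp only [hHdef]
    rw [hGpos w g hw]
  calc ∫⁻ g, ∫⁻ a, G a g = ENNReal.ofReal |M.det| * ∫⁻ g, ∫⁻ a, G a (M *ᵥ g) :=
        lintegral_comp_mulVec hM.det_pos.ne' (Measurable.lintegral_prod_left hGm)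
    _ = ENNReal.ofReal |M.det| * ∫⁻ g, ∫⁻ w in Set.Ioi 0, H w g := by simp only [step]
    _ = ENNReal.ofReal |M.det| * ∫⁻ w in Set.Ioi 0, ∫⁻ g, H w g := by
        rw [lintegral_lintegral_swap]
        exact (hHm.comp measurable_swap).aemeasurable
    _ = ENNReal.ofReal |M.det| * (iwWeight d 1 M * ∫⁻ w in Set.Ioi (0 : ℝ),
          ENNReal.ofReal (w ^ ((d - (k + 1 : ℕ)) / 2 - 1) * Real.exp (-w / 2)) *
            ∫⁻ z : Fin k → ℝ, ENNReal.ofReal (Real.exp (-(z ⬝ᵥ z) / 2)) *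
              F (Fin.cons w (√w • z))) := by
        congr 1
        have hW : iwWeight d 1 M ≠ ∞ := by
          rw [iwWeight_of_posDef hM]; exact ENNReal.ofReal_ne_top
        rw [← lintegral_const_mul' _ _ hW]
        refine setLIntegral_congr_fun measurableSet_Ioi fun w hw => ?_
        have hw' : (0 : ℝ) < w := hw
        have hs : 0 < √w := Real.sqrt_pos.2 hw'
        have hss : √w * √w = w := Real.mul_self_sqrt hw'.le
        have hHw : Measurable (H w) := hHm.comp measurable_prodMk_left
        change ∫⁻ g, H w g = _
        -- The substitution `g = -w^{-1/2} z` turns `w |g|²` into `|z|²` and the column `-w g` into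
        -- `√w z`.
        rw [lintegral_comp_smul_pi (c := -(√w)⁻¹) (by simpa using hs.ne') hHw]
        have hH (z : Fin k → ℝ) : H w (-(√w)⁻¹ • z) =
            (ENNReal.ofReal (w ^ (-2 : ℝ) * (w ^ ((d + 1) / 2) * Real.exp (-w / 2))) *
              iwWeight d 1 M) * (ENNReal.ofReal (Real.exp (-(z ⬝ᵥ z) / 2)) *
                F (Fin.cons w (√w • z))) := by
          have e1 : w * ((-(√w)⁻¹ • z) ⬝ᵥ (-(√w)⁻¹ • z)) = z ⬝ᵥ z := by
            simp only [smul_dotProduct, dotProduct_smul, smul_eq_mul]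
            nth_rw 1 [← hss]
            field_simp
          have e2 : -(w • (-(√w)⁻¹ • z)) = √w • z := by
            rw [smul_smul, ← neg_smul]
            congr 1
            nth_rw 1 [← hss]
            field_simp
          simp only [hHdef]
          rw [e1, e2, ENNReal.ofReal_mul (q := Real.exp (-(z ⬝ᵥ z) / 2)) (by positivity),
            ENNReal.ofReal_mul (p := w ^ (-2 : ℝ)) (by positivity)]
          ring
        simp only [hH]
        -- Powers of `w`: `-k/2` from scaling `g`, `-2` from inverting the Schur complement and
        -- `(d+1)/2` from the weight. They add up to the chi-square exponent for `d - (k+1)` degrees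
        -- of freedom.
        have hreal : |-(√w)⁻¹| ^ k * (w ^ (-2 : ℝ) * (w ^ ((d + 1) / 2) * Real.exp (-w / 2))) =
            w ^ ((d - (k + 1 : ℕ)) / 2 - 1) * Real.exp (-w / 2) := by
          rw [abs_neg, abs_inv, abs_of_pos hs, Real.sqrt_eq_rpow, ← Real.rpow_neg hw'.le,
            ← Real.rpow_natCast, ← Real.rpow_mul hw'.le, ← mul_assoc, ← mul_assoc,
            ← Real.rpow_add hw', ← Real.rpow_add hw']
          congr 2
          push_cast
          ring
        rw [lintegral_const_mul' _ _ (ENNReal.mul_ne_top ENNReal.ofReal_ne_top hW), ← hreal,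
          ENNReal.ofReal_mul (p := |-(√w)⁻¹| ^ k) (by positivity)]
        ring
    _ = _ := by rw [← mul_assoc, ofReal_det_mul_iwWeight hM]

/-! ### Gaussian vectors -/

lemma norm_sq_eq_dotProduct {k : ℕ} (v : EuclideanSpace ℝ (Fin k)) :
    ‖v‖ ^ 2 = v.ofLp ⬝ᵥ v.ofLp := by
  rw [EuclideanSpace.real_norm_sq_eq]
  simp [dotProduct, sq]

lemma integrable_exp_neg_norm_sq (k : ℕ) :
    Integrable fun v : EuclideanSpace ℝ (Fin k) => Real.exp (-‖v‖ ^ 2 / 2) := by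
  have h := (GaussianFourier.integrable_cexp_neg_mul_sq_norm_add
    (V := EuclideanSpace ℝ (Fin k)) (b := (1 / 2 : ℂ)) (by norm_num) 0 0).re
  refine h.congr (.of_forall fun v => ?_)
  have : (-(1 / 2 : ℂ) * (‖v‖ : ℂ) ^ 2 + 0 * ((inner ℝ (0 : EuclideanSpace ℝ (Fin k)) v : ℝ) : ℂ)) =
      ((-‖v‖ ^ 2 / 2 : ℝ) : ℂ) := by push_cast; ring
  simp only [this]
  rw [← Complex.ofReal_exp]
  rfl

/-- Both sides are finite measures, so it suffices to compare characteristic functions, and the left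
one is a Gaussian Fourier integral. -/
lemma withDensity_exp_eq_stdGaussian (k : ℕ) :
    (volume : Measure (EuclideanSpace ℝ (Fin k))).withDensity
        (fun v => ENNReal.ofReal (Real.exp (-‖v‖ ^ 2 / 2))) =
      ENNReal.ofReal ((2 * Real.pi) ^ ((k : ℝ) / 2)) •
        stdGaussian (EuclideanSpace ℝ (Fin k)) := by
  have : IsFiniteMeasure ((volume : Measure (EuclideanSpace ℝ (Fin k))).withDensity
        (fun v => ENNReal.ofReal (Real.exp (-‖v‖ ^ 2 / 2)))) :=
    isFiniteMeasure_withDensity_ofReal (integrable_exp_neg_norm_sq k).2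
  have : IsFiniteMeasure (ENNReal.ofReal ((2 * Real.pi) ^ ((k : ℝ) / 2)) •
        stdGaussian (EuclideanSpace ℝ (Fin k))) :=
    Measure.smul_finite _ ENNReal.ofReal_ne_top
  refine Measure.ext_of_charFun ?_
  ext t
  rw [charFun_apply, charFun_apply, integral_smul_measure,
    ← charFun_apply (μ := stdGaussian (EuclideanSpace ℝ (Fin k))), charFun_stdGaussian,
    integral_withDensity_eq_integral_toReal_smul (by fun_prop) (by simp)]
  have h := GaussianFourier.integral_cexp_neg_mul_sq_norm_add (V := EuclideanSpace ℝ (Fin k))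
    (b := (1 / 2 : ℂ)) (by norm_num) Complex.I t
  have e : ∀ v : EuclideanSpace ℝ (Fin k),
      (ENNReal.ofReal (Real.exp (-‖v‖ ^ 2 / 2))).toReal •
        Complex.exp ((inner ℝ v t : ℝ) * Complex.I) =
      Complex.exp (-(1 / 2 : ℂ) * (‖v‖ : ℂ) ^ 2 + Complex.I * ((inner ℝ t v : ℝ) : ℂ)) := by
    intro v
    rw [ENNReal.toReal_ofReal (by positivity), Complex.exp_add, real_inner_comm, Complex.real_smul,
      Complex.ofReal_exp]
    congr 2
    · push_cast; ring
    · ring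
  simp only [e, h]
  rw [ENNReal.toReal_ofReal (by positivity), Complex.real_smul,
    Complex.ofReal_cpow (by positivity)]
  congr 2
  · push_cast; ring
  · simp
  · rw [Complex.I_sq]; ring

lemma lintegral_exp_dotProduct_mul {k : ℕ} {G : (Fin k → ℝ) → ℝ≥0∞} (hG : Measurable G) :
    ∫⁻ z : Fin k → ℝ, ENNReal.ofReal (Real.exp (-(z ⬝ᵥ z) / 2)) * G z =
      ENNReal.ofReal ((2 * Real.pi) ^ ((k : ℝ) / 2)) *
        ∫⁻ y, G y.ofLp ∂stdGaussian (EuclideanSpace ℝ (Fin k)) := by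
  have hm : Measurable fun z : Fin k → ℝ => ENNReal.ofReal (Real.exp (-(z ⬝ᵥ z) / 2)) * G z := by
    have := measurable_dotProduct (measurable_id (α := Fin k → ℝ)) measurable_id
    simp only [id] at this
    fun_prop
  rw [← (PiLp.volume_preserving_ofLp (Fin k)).lintegral_comp hm, ← smul_eq_mul,
    ← lintegral_smul_measure, ← withDensity_exp_eq_stdGaussian,
    lintegral_withDensity_eq_lintegral_mul _ (by fun_prop) (by fun_prop)]
  refine lintegral_congr fun v => ?_
  simp [norm_sq_eq_dotProduct]

lemma charFun_map_mulVec_stdGaussian {m p : ℕ} (A : Matrix (Fin p) (Fin m) ℝ)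
    (t : EuclideanSpace ℝ (Fin p)) :
    charFun ((stdGaussian (EuclideanSpace ℝ (Fin m))).map
        (fun y => WithLp.toLp 2 (A *ᵥ y.ofLp))) t =
      Complex.exp (-((t.ofLp ⬝ᵥ ((A * Aᵀ) *ᵥ t.ofLp) : ℝ) : ℂ) / 2) := by
  have hm : Measurable fun y : EuclideanSpace ℝ (Fin m) =>
      (WithLp.toLp 2 (A *ᵥ y.ofLp) : EuclideanSpace ℝ (Fin p)) :=
    (WithLp.measurable_toLp 2 _).comp
      (measurable_mulVec (M := fun _ => A) (fun _ _ => measurable_const)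
      (WithLp.measurable_ofLp 2 _))
  have hin (y : EuclideanSpace ℝ (Fin m)) :
      inner ℝ (WithLp.toLp 2 (A *ᵥ y.ofLp) : EuclideanSpace ℝ (Fin p)) t =
        inner ℝ y (WithLp.toLp 2 (Aᵀ *ᵥ t.ofLp)) := by
    simp only [EuclideanSpace.inner_eq_star_dotProduct, star_trivial]
    rw [mulVec_transpose, ← dotProduct_mulVec]
  rw [charFun_apply, integral_map hm.aemeasurable (by fun_prop)]
  simp only [hin]
  rw [← charFun_apply, charFun_stdGaussian, ← Complex.ofReal_pow, norm_sq_eq_dotProduct]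
  congr 4
  rw [← mulVec_mulVec, dotProduct_mulVec t.ofLp, ← mulVec_transpose]

/-- The characteristic function of the image law involves the matrix only through `A Aᵀ`. The
numbers of columns may differ, which allows a rectangular factor to be exchanged for a square root.
-/
lemma lintegral_mulVec_stdGaussian {m m' p : ℕ} {A : Matrix (Fin p) (Fin m) ℝ}
    {A' : Matrix (Fin p) (Fin m') ℝ} (h : A * Aᵀ = A' * A'ᵀ) {G : (Fin p → ℝ) → ℝ≥0∞}
    (hG : Measurable G) :
    ∫⁻ y, G (A *ᵥ y.ofLp) ∂stdGaussian (EuclideanSpace ℝ (Fin m)) =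
      ∫⁻ y, G (A' *ᵥ y.ofLp) ∂stdGaussian (EuclideanSpace ℝ (Fin m')) := by
  have hm {m : ℕ} (A : Matrix (Fin p) (Fin m) ℝ) : Measurable fun y : EuclideanSpace ℝ (Fin m) =>
      (WithLp.toLp 2 (A *ᵥ y.ofLp) : EuclideanSpace ℝ (Fin p)) :=
    (WithLp.measurable_toLp 2 _).comp
      (measurable_mulVec (M := fun _ => A) (fun _ _ => measurable_const)
      (WithLp.measurable_ofLp 2 _))
  have hlaw : (stdGaussian (EuclideanSpace ℝ (Fin m))).map
        (fun y => (WithLp.toLp 2 (A *ᵥ y.ofLp) : EuclideanSpace ℝ (Fin p))) =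
      (stdGaussian (EuclideanSpace ℝ (Fin m'))).map
        (fun y => (WithLp.toLp 2 (A' *ᵥ y.ofLp) : EuclideanSpace ℝ (Fin p))) := by
    have := Measure.isProbabilityMeasure_map (μ := stdGaussian (EuclideanSpace ℝ (Fin m)))
      (hm A).aemeasurable
    have := Measure.isProbabilityMeasure_map (μ := stdGaussian (EuclideanSpace ℝ (Fin m')))
      (hm A').aemeasurable
    refine Measure.ext_of_charFun ?_
    ext t
    rw [charFun_map_mulVec_stdGaussian, charFun_map_mulVec_stdGaussian, h]
  have hG' : Measurable fun y : EuclideanSpace ℝ (Fin p) => G y.ofLp := by fun_prop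
  have h1 := lintegral_map (μ := stdGaussian (EuclideanSpace ℝ (Fin m))) hG' (hm A)
  have h2 := lintegral_map (μ := stdGaussian (EuclideanSpace ℝ (Fin m'))) hG' (hm A')
  exact h1.symm.trans ((congrArg (fun ρ => ∫⁻ y, G y.ofLp ∂ρ) hlaw).trans h2)

/-! ### Square roots and factorizations -/

lemma isSymm_sqrt {k : ℕ} (S : Matrix (Fin k) (Fin k) ℝ) : (CFC.sqrt S)ᵀ = CFC.sqrt S :=
  isHermitian_iff_isSymm.1 (nonneg_iff_posSemidef.1 (CFC.sqrt_nonneg S)).1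

lemma sqrt_mul_sqrt_of_posDef {k : ℕ} {S : Matrix (Fin k) (Fin k) ℝ} (hS : S.PosDef) :
    CFC.sqrt S * CFC.sqrt S = S :=
  CFC.sqrt_mul_sqrt_self S hS.posSemidef.nonneg

lemma det_sqrt_ne_zero {k : ℕ} {S : Matrix (Fin k) (Fin k) ℝ} (hS : S.PosDef) :
    (CFC.sqrt S).det ≠ 0 := by
  have h := congrArg det (sqrt_mul_sqrt_of_posDef hS)
  rw [det_mul] at h
  intro h0
  rw [h0, zero_mul] at h
  exact hS.det_pos.ne h

/-- Extend the normalized vector to an orthonormal basis; for `v = 0` any unit vector serves, with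
`c = 0`. -/
lemma exists_orthogonal_col {k : ℕ} (v : Fin (k + 1) → ℝ) :
    ∃ (O : Matrix (Fin (k + 1)) (Fin (k + 1)) ℝ) (c : ℝ), Oᵀ * O = 1 ∧
      v = c • (O *ᵥ Pi.single 0 1) := by
  obtain ⟨e, he, c, hc⟩ : ∃ e : EuclideanSpace ℝ (Fin (k + 1)), ‖e‖ = 1 ∧
      ∃ c : ℝ, v = c • e.ofLp := by
    by_cases hv : v = 0
    · exact ⟨EuclideanSpace.single 0 1, by simp, 0, by simp [hv]⟩
    · have hn : ‖(WithLp.toLp 2 v : EuclideanSpace ℝ (Fin (k + 1)))‖ ≠ 0 := by simpa using hv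
      refine ⟨‖(WithLp.toLp 2 v : EuclideanSpace ℝ (Fin (k + 1)))‖⁻¹ • WithLp.toLp 2 v, ?_,
        ‖(WithLp.toLp 2 v : EuclideanSpace ℝ (Fin (k + 1)))‖, ?_⟩
      · rw [norm_smul, norm_inv, norm_norm, inv_mul_cancel₀ hn]
      · simp [smul_smul, mul_inv_cancel₀ hn]
  have horth : Orthonormal ℝ (({0} : Set (Fin (k + 1))).domRestrict fun _ => e) :=
    ⟨fun _ => he, fun i j hij => absurd (Subsingleton.elim i j) hij⟩
  obtain ⟨b, hb⟩ := horth.exists_orthonormalBasis_extension_of_card_eq (by simp)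
  refine ⟨Matrix.of fun i j => b j i, c, ?_, ?_⟩
  · ext i j
    have := orthonormal_iff_ite.1 b.orthonormal i j
    rw [EuclideanSpace.inner_eq_star_dotProduct, star_trivial] at this
    rw [one_apply, ← this, mul_apply]
    simp [dotProduct, mul_comm]
  · rw [hc]
    congr 1
    ext i
    simp [hb 0 rfl]

/-- Take `B = A^{1/2} O`, with `O` orthogonal and its first column along `A^{-1/2} v`. -/
lemma exists_factor {k : ℕ} {A : Matrix (Fin (k + 1)) (Fin (k + 1)) ℝ} (hA : A.PosDef)
    (v : Fin (k + 1) → ℝ) :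
    ∃ (B : Matrix (Fin (k + 1)) (Fin (k + 1)) ℝ) (c : ℝ), B.det ≠ 0 ∧ B * Bᵀ = A ∧
      v = c • (B *ᵥ Pi.single 0 1) := by
  obtain ⟨O, c, hO, hv⟩ := exists_orthogonal_col ((CFC.sqrt A)⁻¹ *ᵥ v)
  have hdet := det_sqrt_ne_zero hA
  have hO' : O * Oᵀ = 1 := mul_eq_one_comm.1 hO
  have hBB : CFC.sqrt A * O * (CFC.sqrt A * O)ᵀ = A := by
    rw [transpose_mul, isSymm_sqrt, Matrix.mul_assoc, ← Matrix.mul_assoc O, hO', Matrix.one_mul,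
      sqrt_mul_sqrt_of_posDef hA]
  refine ⟨CFC.sqrt A * O, c, ?_, hBB, ?_⟩
  · intro h0
    have := congrArg det hBB
    rw [det_mul, h0, zero_mul] at this
    exact hA.det_pos.ne this
  · rw [← mulVec_mulVec, ← mulVec_smul, ← hv, mulVec_mulVec, mul_nonsing_inv _ hdet.isUnit,
      one_mulVec]

/-! ### Inverse Wishart weights with a general scale matrix -/

/-- The trace is invariant: `tr((B M Bᵀ)⁻¹ B Bᵀ) = tr M⁻¹`. Only the determinant contributes a
factor. -/
lemma iwWeight_congr {k : ℕ} {A B : Matrix (Fin k) (Fin k) ℝ} (hB : B.det ≠ 0)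
    (hBA : B * Bᵀ = A) (d : ℝ) (M : Matrix (Fin k) (Fin k) ℝ) :
    iwWeight d A (B * M * Bᵀ) = ENNReal.ofReal (|B.det| ^ (-(d + 1))) * iwWeight d 1 M := by
  have hBu : IsUnit B := (isUnit_iff_isUnit_det B).2 hB.isUnit
  have hiff : (B * M * Bᵀ).PosDef ↔ M.PosDef := hBu.posDef_star_right_conjugate_iff
  by_cases hM : M.PosDef
  swap
  · rw [iwWeight_of_not_posDef hM, iwWeight_of_not_posDef (mt hiff.1 hM), mul_zero]
  have hd : 0 < |B.det| := abs_pos.2 hB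
  rw [iwWeight_of_posDef hM, iwWeight_of_posDef (hiff.2 hM), ← ENNReal.ofReal_mul (by positivity),
    ← mul_assoc]
  congr 2
  · rw [det_mul, det_mul, det_transpose, mul_right_comm, ← abs_mul_abs_self B.det,
      Real.mul_rpow (by positivity) hM.det_pos.le, Real.mul_rpow hd.le hd.le, ← Real.rpow_add hd]
    congr 2
    ring
  · congr 3
    rw [← hBA, Matrix.mul_inv_rev, Matrix.mul_inv_rev, mul_one, Matrix.mul_assoc, Matrix.mul_assoc,
      trace_mul_comm, Matrix.mul_assoc, Matrix.mul_assoc, Matrix.mul_assoc,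
      mul_nonsing_inv _ (by simpa using hB.isUnit), mul_one, nonsing_inv_mul _ hB.isUnit, mul_one]

/-- Substitute `Σ = B M Bᵀ` in dimension `k + 1`: the Jacobian `|det B|^{k+2}` and the weight factor
`|det B|^{-(d+1)}` combine into the power of `det A`. When `A` depends on `μ`, this power becomes
the marginal density of `μ`. -/
lemma lintegral_iwWeight_eq {k : ℕ} {A B : Matrix (Fin (k + 1)) (Fin (k + 1)) ℝ}
    (hB : B.det ≠ 0) (hBA : B * Bᵀ = A) (d c : ℝ) {F : (Fin (k + 1) → ℝ) → ℝ≥0∞}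
    (hF : Measurable F) :
    ∫⁻ s : UpperIdx (k + 1) → ℝ, iwWeight d A (symMatrix s) *
        F ((symMatrix s)⁻¹ *ᵥ (c • (B *ᵥ Pi.single 0 1))) =
      ENNReal.ofReal (A.det ^ (-(d - (k + 1 : ℕ)) / 2)) *
        ∫⁻ s : UpperIdx (k + 1) → ℝ, iwWeight d 1 (symMatrix s) *
          F (c • (B⁻¹ᵀ *ᵥ ((symMatrix s)⁻¹ *ᵥ Pi.single 0 1))) := by
  have hd : 0 < |B.det| := abs_pos.2 hB
  have hG : Measurable fun s : UpperIdx (k + 1) → ℝ => iwWeight d A (symMatrix s) *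
        F ((symMatrix s)⁻¹ *ᵥ (c • (B *ᵥ Pi.single 0 1))) :=
    (measurable_iwWeight d A).mul (hF.comp (measurable_mulVec
      (measurable_inv_apply measurable_symMatrix_apply) measurable_const))
  rw [lintegral_comp_congrLin hB hG]
  have h1 (s : UpperIdx (k + 1) → ℝ) :
      (B * symMatrix s * Bᵀ)⁻¹ *ᵥ (c • (B *ᵥ Pi.single 0 1)) =
        c • (B⁻¹ᵀ *ᵥ ((symMatrix s)⁻¹ *ᵥ Pi.single 0 1)) := by
    rw [mulVec_smul, Matrix.mul_inv_rev, Matrix.mul_inv_rev, mulVec_mulVec, mulVec_mulVec,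
      Matrix.mul_assoc, Matrix.mul_assoc, nonsing_inv_mul _ hB.isUnit, mul_one,
      transpose_nonsing_inv]
  simp only [symMatrix_congrLin, iwWeight_congr hB hBA, h1]
  simp only [mul_assoc]
  rw [lintegral_const_mul' _ _ ENNReal.ofReal_ne_top, ← mul_assoc,
    ← ENNReal.ofReal_mul (by positivity), ← hBA, det_mul, det_transpose, ← abs_mul_abs_self B.det,
    Real.mul_rpow hd.le hd.le, ← Real.rpow_natCast, ← Real.rpow_add hd, ← Real.rpow_add hd]
  congr 3
  push_cast
  ring

lemma lintegral_gammaMeasure {a : ℝ} (ha : 0 < a) (G : ℝ → ℝ≥0∞) (hG : Measurable G) :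
    ∫⁻ w in Set.Ioi (0 : ℝ), ENNReal.ofReal (w ^ (a - 1) * Real.exp (-w / 2)) * G w =
      ENNReal.ofReal (Real.Gamma a / (1 / 2) ^ a) * ∫⁻ w, G w ∂gammaMeasure a (1 / 2) := by
  have hΓ := Real.Gamma_pos_of_pos ha
  have hpdf : Measurable (gammaPDF a (1 / 2)) := (measurable_gammaPDFReal a _).ennreal_ofReal
  rw [gammaMeasure, lintegral_withDensity_eq_lintegral_mul _ hpdf hG,
    ← lintegral_const_mul' _ _ ENNReal.ofReal_ne_top, ← lintegral_indicator measurableSet_Ioi]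
  -- The gamma density is given by its formula also at `0`, whereas the left integral runs over `w >
  -- 0`; the point is null.
  have h0 : ∀ᵐ w : ℝ, w ≠ 0 := by simp [ae_iff]
  refine lintegral_congr_ae ?_
  filter_upwards [h0] with w hw
  rcases lt_or_gt_of_ne hw with h | h
  · rw [Set.indicator_of_notMem (by simpa using h.le)]
    simp [gammaPDF_of_neg h]
  · rw [Set.indicator_of_mem (Set.mem_Ioi.2 h), Pi.mul_apply, gammaPDF_of_nonneg h.le, ← mul_assoc,
      ← ENNReal.ofReal_mul (by positivity)]
    congr 2
    rw [show -(1 / 2 * w) = -w / 2 by ring]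
    field_simp

lemma isProbabilityMeasure_chiSq {ν : ℝ} (hν : 0 < ν) : IsProbabilityMeasure (chiSq ν) :=
  isProbabilityMeasure_gammaMeasure (by positivity) (by norm_num)

/-- The first column of the inverse matrix under `iwWeight d 1`, through a chi-square variable
and an independent standard normal vector. -/
lemma lintegral_iwWeight_one_inv_col' {k : ℕ} {d : ℝ} (hd : (k + 1 : ℕ) < d)
    {F : (Fin (k + 1) → ℝ) → ℝ≥0∞} (hF : Measurable F) :
    ∫⁻ s : UpperIdx (k + 1) → ℝ,
        iwWeight d 1 (symMatrix s) * F ((symMatrix s)⁻¹ *ᵥ Pi.single 0 1) =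
      ((∫⁻ t : UpperIdx k → ℝ, iwWeight (d - 2) 1 (symMatrix t)) *
        (ENNReal.ofReal (Real.Gamma ((d - (k + 1 : ℕ)) / 2) / (1 / 2) ^ ((d - (k + 1 : ℕ)) / 2)) *
          ENNReal.ofReal ((2 * Real.pi) ^ ((k : ℝ) / 2)))) *
        ∫⁻ w, ∫⁻ z, F (Fin.cons w (√w • z.ofLp)) ∂stdGaussian (EuclideanSpace ℝ (Fin k))
          ∂chiSq (d - (k + 1 : ℕ)) := by
  have hF' : Measurable fun p : ℝ × EuclideanSpace ℝ (Fin k) =>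
      F (Fin.cons p.1 (√p.1 • p.2.ofLp)) :=
    hF.comp (measurable_cons measurable_fst (measurable_fst.sqrt.smul
      ((WithLp.measurable_ofLp 2 _).comp measurable_snd)))
  have hz (w : ℝ) : ∫⁻ z : Fin k → ℝ, ENNReal.ofReal (Real.exp (-(z ⬝ᵥ z) / 2)) *
        F (Fin.cons w (√w • z)) =
      ENNReal.ofReal ((2 * Real.pi) ^ ((k : ℝ) / 2)) *
        ∫⁻ z, F (Fin.cons w (√w • z.ofLp)) ∂stdGaussian (EuclideanSpace ℝ (Fin k)) :=
    lintegral_exp_dotProduct_mul (G := fun z => F (Fin.cons w (√w • z)))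
      (hF.comp (measurable_cons measurable_const (measurable_const_smul (√w))))
  rw [lintegral_iwWeight_one_inv_col d hF]
  simp only [hz, mul_left_comm _ (ENNReal.ofReal ((2 * Real.pi) ^ ((k : ℝ) / 2)))]
  rw [lintegral_const_mul' _ _ ENNReal.ofReal_ne_top,
    lintegral_gammaMeasure (a := (d - (k + 1 : ℕ)) / 2) (by linarith) _
      (Measurable.lintegral_prod_right' hF'), chiSq]
  ring

/-- Induction on the dimension through the first-column formula with `F = 1`. Passing to the block
replaces `(k, d)` by `(k-1, d-2)`, which preserves `2k < d`. -/
lemma lintegral_iwWeight_one_ne {k : ℕ} {d : ℝ} (hd : 2 * (k : ℝ) < d) :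
    (∫⁻ t : UpperIdx k → ℝ, iwWeight d 1 (symMatrix t)) ≠ 0 ∧
      (∫⁻ t : UpperIdx k → ℝ, iwWeight d 1 (symMatrix t)) ≠ ∞ := by
  induction k generalizing d with
  | zero =>
    have h1 (t : UpperIdx 0 → ℝ) : iwWeight d 1 (symMatrix t) = 1 := by
      have hM : (symMatrix t).PosDef := by
        rw [Subsingleton.elim (symMatrix t) 1]; exact PosDef.one
      rw [iwWeight_of_posDef hM]
      simp [trace]
    simp only [h1, lintegral_const, one_mul, volume_pi]
    rw [Measure.pi_of_empty]
    simp
  | succ k ih =>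
    push_cast at hd
    have hk : ((k + 1 : ℕ) : ℝ) < d := by push_cast; have := k.cast_nonneg (α := ℝ); linarith
    have hpos : 0 < (d - (k + 1 : ℕ)) / 2 := by linarith
    have h := lintegral_iwWeight_one_inv_col' hk (F := fun _ => 1) measurable_const
    have := isProbabilityMeasure_chiSq (sub_pos.2 hk)
    simp only [mul_one, lintegral_const, measure_univ] at h
    rw [h]
    obtain ⟨h1, h2⟩ := ih (d := d - 2) (by linarith)
    have h3 : ENNReal.ofReal (Real.Gamma ((d - (k + 1 : ℕ)) / 2) /
        (1 / 2) ^ ((d - (k + 1 : ℕ)) / 2)) ≠ 0 := by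
      have := Real.Gamma_pos_of_pos hpos
      rw [ENNReal.ofReal_ne_zero_iff]
      positivity
    have h4 : ENNReal.ofReal ((2 * Real.pi) ^ ((k : ℝ) / 2)) ≠ 0 := by
      rw [ENNReal.ofReal_ne_zero_iff]
      positivity
    exact ⟨mul_ne_zero h1 (mul_ne_zero h3 h4), ENNReal.mul_ne_top h2
      (ENNReal.mul_ne_top ENNReal.ofReal_ne_top ENNReal.ofReal_ne_top)⟩

/-- The covariance matrix `ε L V Lᵀ - (L ζ) (L ζ)ᵀ`, with `ζ = V v` and `ε = v ⬝ ζ`. -/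
lemma factor_identity {k p : ℕ} {A B : Matrix (Fin (k + 1)) (Fin (k + 1)) ℝ}
    (hB : B.det ≠ 0) (hBA : B * Bᵀ = A) (c : ℝ) (L : Matrix (Fin p) (Fin (k + 1)) ℝ)
    {v : Fin (k + 1) → ℝ} (hv : v = c • (B *ᵥ Pi.single 0 1)) :
    ∃ D : Matrix (Fin p) (Fin k) ℝ,
      D * Dᵀ = (v ⬝ᵥ (A⁻¹ *ᵥ v)) • (L * A⁻¹ * Lᵀ) - L * vecMulVec (A⁻¹ *ᵥ v) (A⁻¹ *ᵥ v) * Lᵀ ∧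
      ∀ (w r : ℝ) (z : Fin k → ℝ), L *ᵥ (c • (B⁻¹ᵀ *ᵥ (Fin.cons w (r • z) : Fin (k + 1) → ℝ))) =
        w • (L *ᵥ (A⁻¹ *ᵥ v)) + r • (D *ᵥ z) := by
  set e : Fin (k + 1) → ℝ := Pi.single 0 1
  -- `E` embeds the last `k` coordinates, so that `(w, r z) = w e + r E z` and `E Eᵀ = 1 - e eᵀ`.
  set E : Matrix (Fin (k + 1)) (Fin k) ℝ :=
    (1 : Matrix (Fin (k + 1)) (Fin (k + 1)) ℝ).submatrix id Fin.succ
  have hE : E * Eᵀ = 1 - vecMulVec e e := by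
    ext i j
    rw [mul_apply]
    have h := congrFun (congrFun (Matrix.mul_one (1 : Matrix (Fin (k + 1)) (Fin (k + 1)) ℝ)) i) j
    rw [mul_apply, Fin.sum_univ_succ] at h
    rw [Matrix.sub_apply, ← h]
    refine Fin.cases ?_ (fun i => ?_) i <;> refine Fin.cases ?_ (fun j => ?_) j <;>
      simp [E, e, vecMulVec_apply, one_apply, Fin.succ_ne_zero, eq_comm]
  have hcons (w r : ℝ) (z : Fin k → ℝ) :
      (Fin.cons w (r • z) : Fin (k + 1) → ℝ) = w • e + r • (E *ᵥ z) := by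
    ext i
    refine Fin.cases ?_ (fun i => ?_) i
    · simp [E, e, mulVec, dotProduct, one_apply, (Fin.succ_ne_zero _).symm]
    · simp [E, e, mulVec, dotProduct, one_apply]
  have hBi : B⁻¹ *ᵥ v = c • e := by
    rw [hv, mulVec_smul, mulVec_mulVec, nonsing_inv_mul _ hB.isUnit, one_mulVec]
  have hAi : A⁻¹ = B⁻¹ᵀ * B⁻¹ := by
    rw [← hBA, Matrix.mul_inv_rev, transpose_nonsing_inv]
  have hζ : A⁻¹ *ᵥ v = c • (B⁻¹ᵀ *ᵥ e) := by
    rw [hAi, ← mulVec_mulVec, hBi, mulVec_smul]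
  have hε : v ⬝ᵥ (A⁻¹ *ᵥ v) = c ^ 2 := by
    rw [hAi, ← mulVec_mulVec, dotProduct_mulVec, ← mulVec_transpose, transpose_transpose, hBi]
    simp [e]
    ring
  -- With this `D`, `D Dᵀ = c² L B⁻ᵀ (1 - e eᵀ) B⁻¹ Lᵀ`. Here `c² = ε` and `B⁻ᵀ B⁻¹ = A⁻¹`, and the
  -- subtracted term is `Lζ(Lζ)ᵀ` because `ζ = c B⁻ᵀ e`.
  refine ⟨c • (L * (B⁻¹ᵀ * E)), ?_, fun w r z => ?_⟩
  · rw [hε, hζ, hAi]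
    have h1 : vecMulVec (c • (B⁻¹ᵀ *ᵥ e)) (c • (B⁻¹ᵀ *ᵥ e)) =
        c ^ 2 • (B⁻¹ᵀ * vecMulVec e e * B⁻¹) := by
      rw [smul_vecMulVec, vecMulVec_smul, smul_smul, ← sq, mul_vecMulVec, vecMulVec_mul,
        mulVec_transpose]
    rw [h1]
    calc _ = c ^ 2 • (L * (B⁻¹ᵀ * (E * Eᵀ) * B⁻¹) * Lᵀ) := by
          simp only [transpose_smul, transpose_mul, transpose_transpose, Matrix.smul_mul,
            Matrix.mul_smul, smul_smul, Matrix.mul_assoc, sq]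
      _ = _ := by
          rw [hE]
          simp only [Matrix.mul_sub, Matrix.sub_mul, mul_one, smul_sub, Matrix.smul_mul,
            Matrix.mul_smul]
  · rw [hcons, hζ]
    simp only [mulVec_add, mulVec_smul, smul_add, smul_mulVec, ← mulVec_mulVec, smul_smul]
    rw [mul_comm c w, mul_comm c r]

/-- For a matrix `Σ` with weight `iwWeight d A`, the law of `L Σ⁻¹ v`. -/
lemma exists_lintegral_iwWeight_inv_mulVec {k : ℕ} (hk : 0 < k) {d : ℝ} (hd : 2 * (k : ℝ) < d) :
    ∃ c₀ : ℝ≥0∞, c₀ ≠ 0 ∧ c₀ ≠ ∞ ∧ ∀ {p : ℕ} {A : Matrix (Fin k) (Fin k) ℝ}, A.PosDef →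
      ∀ (L : Matrix (Fin p) (Fin k) ℝ) (v : Fin k → ℝ) (f : (Fin p → ℝ) → ℝ≥0∞), Measurable f →
        ∫⁻ s : UpperIdx k → ℝ, iwWeight d A (symMatrix s) * f (L *ᵥ ((symMatrix s)⁻¹ *ᵥ v)) =
          c₀ * (ENNReal.ofReal (A.det ^ (-(d - k) / 2)) *
            ∫⁻ w, ∫⁻ z, f (w • (L *ᵥ (A⁻¹ *ᵥ v)) + √w • (CFC.sqrt ((v ⬝ᵥ (A⁻¹ *ᵥ v)) •
              (L * A⁻¹ * Lᵀ) - L * vecMulVec (A⁻¹ *ᵥ v) (A⁻¹ *ᵥ v) * Lᵀ) *ᵥ z.ofLp))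
              ∂stdGaussian (EuclideanSpace ℝ (Fin p)) ∂chiSq (d - k)) := by
  obtain ⟨k, rfl⟩ := Nat.exists_eq_succ_of_ne_zero hk.ne'
  rw [Nat.succ_eq_add_one] at *
  have hk' : ((k + 1 : ℕ) : ℝ) < d := by
    have := (k + 1).cast_nonneg (α := ℝ); linarith
  have hpos : 0 < (d - (k + 1 : ℕ)) / 2 := by linarith
  obtain ⟨h1, h2⟩ := lintegral_iwWeight_one_ne (k := k) (d := d - 2) (by push_cast at hd; linarith)
  have h3 : ENNReal.ofReal (Real.Gamma ((d - (k + 1 : ℕ)) / 2) /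
      (1 / 2) ^ ((d - (k + 1 : ℕ)) / 2)) ≠ 0 := by
    have := Real.Gamma_pos_of_pos hpos
    rw [ENNReal.ofReal_ne_zero_iff]
    positivity
  have h4 : ENNReal.ofReal ((2 * Real.pi) ^ ((k : ℝ) / 2)) ≠ 0 := by
    rw [ENNReal.ofReal_ne_zero_iff]
    positivity
  -- The constant is the mass of the block weight times the gamma and Gaussian normalizers. It
  -- involves neither `A` nor `v`, so it can be pulled out when these vary with `μ`.
  refine ⟨_, mul_ne_zero h1 (mul_ne_zero h3 h4), ENNReal.mul_ne_top h2
      (ENNReal.mul_ne_top ENNReal.ofReal_ne_top ENNReal.ofReal_ne_top), ?_⟩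
  intro p A hA L v f hf
  obtain ⟨B, c, hB, hBA, hv⟩ := exists_factor hA v
  obtain ⟨D, hD, hLD⟩ := factor_identity hB hBA c L hv
  have hfL : Measurable fun y : Fin (k + 1) → ℝ => f (L *ᵥ y) :=
    hf.comp (measurable_mulVec (M := fun _ => L) (fun _ _ => measurable_const) measurable_id)
  have hfB : Measurable fun y : Fin (k + 1) → ℝ => f (L *ᵥ (c • (B⁻¹ᵀ *ᵥ y))) :=
    hfL.comp ((measurable_mulVec (M := fun _ => B⁻¹ᵀ) (fun _ _ => measurable_const)
      measurable_id).const_smul c)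
  have e1 := lintegral_iwWeight_eq hB hBA d c hfL
  rw [← hv] at e1
  rw [e1, lintegral_iwWeight_one_inv_col' hk' hfB]
  simp only [hLD]
  rw [mul_left_comm]
  congr 2
  refine lintegral_congr fun w => ?_
  -- The factor `D` has one column per remaining coordinate of the inverse column, while the
  -- representation uses a `p × p` square root and `p` normal variables. The two Gaussian vectors
  -- have the same covariance.
  have hDs : D * Dᵀ = CFC.sqrt (D * Dᵀ) * (CFC.sqrt (D * Dᵀ))ᵀ := by
    rw [isSymm_sqrt, CFC.sqrt_mul_sqrt_self (D * Dᵀ)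
      (nonneg_iff_posSemidef.2 (posSemidef_self_mul_conjTranspose D))]
  rw [← hD]
  exact lintegral_mulVec_stdGaussian hDs (G := fun y => f (w • (L *ᵥ (A⁻¹ *ᵥ v)) + √w • y))
    (hf.comp (measurable_const.add (measurable_const_smul (√w))))

/-! ### Polar coordinates and the `F`-distribution -/

lemma lintegral_polar {k : ℕ} (hk : 0 < k) {Θ : EuclideanSpace ℝ (Fin k) → ℝ≥0∞}
    (hΘ : Measurable Θ) :
    ∫⁻ y, Θ y = ∫⁻ u : UnitSphere k, (∫⁻ r in Set.Ioi (0 : ℝ),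
      ENNReal.ofReal (r ^ (k - 1)) * Θ (r • u.1))
        ∂(volume : Measure (EuclideanSpace ℝ (Fin k))).toSphere := by
  have : Nonempty (Fin k) := ⟨⟨0, hk⟩⟩
  have hmp :=
    (volume : Measure (EuclideanSpace ℝ (Fin k))).measurePreserving_homeomorphUnitSphereProd
  have hsm : Measurable fun x : UnitSphere k × Set.Ioi (0 : ℝ) => Θ (x.2.1 • x.1.1) :=
    hΘ.comp ((measurable_subtype_coe.comp measurable_snd).smul
      (measurable_subtype_coe.comp measurable_fst))
  have e1 : ∫⁻ y, Θ y = ∫⁻ y : ({0}ᶜ : Set (EuclideanSpace ℝ (Fin k))), Θ y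
      ∂(volume.comap Subtype.val) := by
    rw [lintegral_subtype_comap (measurableSet_singleton _).compl, restrict_compl_singleton]
  have e2 : ∀ y : ({0}ᶜ : Set (EuclideanSpace ℝ (Fin k))), Θ y =
      (fun x : UnitSphere k × Set.Ioi (0 : ℝ) => Θ (x.2.1 • x.1.1))
        (homeomorphUnitSphereProd (EuclideanSpace ℝ (Fin k)) y) := by
    intro y
    have := (homeomorphUnitSphereProd (EuclideanSpace ℝ (Fin k))).symm_apply_apply y
    conv_lhs => rw [← this]
    rfl
  rw [e1]
  simp only [e2]
  rw [hmp.lintegral_comp hsm, lintegral_prod _ hsm.aemeasurable]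
  refine lintegral_congr fun u => ?_
  have hu : Measurable fun r : Set.Ioi (0 : ℝ) => Θ (r.1 • u.1) :=
    hsm.comp measurable_prodMk_left
  rw [Measure.volumeIoiPow, lintegral_withDensity_eq_lintegral_mul _ (by fun_prop) hu,
    finrank_euclideanSpace_fin]
  exact lintegral_subtype_comap (μ := volume) measurableSet_Ioi
    (fun r : ℝ => ENNReal.ofReal (r ^ (k - 1)) * Θ (r • u.1))

lemma lintegral_Ioi_sqrt {κ : ℝ} (hκ : 0 < κ) (G : ℝ → ℝ≥0∞) :
    ∫⁻ r in Set.Ioi 0, G r =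
      ∫⁻ y in Set.Ioi 0, ENNReal.ofReal (κ / (2 * √(κ * y))) * G √(κ * y) := by
  have him : (fun y : ℝ => √(κ * y)) '' Set.Ioi 0 = Set.Ioi 0 := by
    ext r
    simp only [Set.mem_image, Set.mem_Ioi]
    constructor
    · rintro ⟨y, hy, rfl⟩
      positivity
    · intro hr
      refine ⟨r ^ 2 / κ, by positivity, ?_⟩
      rw [mul_div_cancel₀ _ hκ.ne', Real.sqrt_sq hr.le]
  have h := lintegral_image_eq_lintegral_abs_deriv_mul (f := fun y : ℝ => √(κ * y))
    (f' := fun y => κ / (2 * √(κ * y))) (s := Set.Ioi 0) measurableSet_Ioi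
    (fun y hy => by
      have hy' : 0 < κ * y := mul_pos hκ hy
      have := ((hasDerivAt_id y).const_mul κ).sqrt hy'.ne'
      simpa using this.hasDerivWithinAt)
    (fun x hx y hy h => by
      have hx' : 0 < κ * x := mul_pos hκ hx
      have hy' : 0 < κ * y := mul_pos hκ hy
      exact mul_left_cancel₀ hκ.ne' ((Real.sqrt_inj hx'.le hy'.le).1 h)) G
  rw [him] at h
  rw [h]
  refine setLIntegral_congr_fun measurableSet_Ioi fun y hy => ?_
  have hy' : 0 < κ * y := mul_pos hκ hy
  have : 0 < √(κ * y) := Real.sqrt_pos.2 hy'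
  rw [abs_of_pos (by positivity)]

/-- The substitution `r² = k y / δ` carries the radial density of a multivariate t law to the
density of `F(k, δ)`. -/
lemma exists_lintegral_fisherF {k : ℕ} (hk : 0 < k) {δ : ℝ} (hδ : 0 < δ) :
    ∃ c : ℝ≥0∞, c ≠ 0 ∧ c ≠ ∞ ∧ ∀ G : ℝ → ℝ≥0∞, Measurable G →
      ∫⁻ r in Set.Ioi (0 : ℝ), ENNReal.ofReal (r ^ (k - 1)) *
          (ENNReal.ofReal ((1 + r ^ 2) ^ (-(k + δ) / 2)) * G (r ^ 2)) =
        c * ∫⁻ y, G (k * y / δ) ∂fisherF k δ := by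
  have hk' : (0 : ℝ) < k := by exact_mod_cast hk
  have hκ : (0 : ℝ) < k / δ := by positivity
  have hβ : 0 < ProbabilityTheory.beta ((k : ℝ) / 2) (δ / 2) :=
    beta_pos (by positivity) (by positivity)
  refine ⟨ENNReal.ofReal (ProbabilityTheory.beta ((k : ℝ) / 2) (δ / 2) / 2), ?_,
    ENNReal.ofReal_ne_top, fun G hG => ?_⟩
  · rw [ENNReal.ofReal_ne_zero_iff]; positivity
  have hG' : Measurable fun y : ℝ => G (k * y / δ) :=
    hG.comp ((measurable_id.const_mul _).div_const _)
  rw [fisherF, lintegral_withDensity_eq_lintegral_mul _ ?_ hG',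
    ← lintegral_const_mul' _ _ ENNReal.ofReal_ne_top, lintegral_Ioi_sqrt hκ,
    ← lintegral_indicator measurableSet_Ioi]
  · refine lintegral_congr fun y => ?_
    by_cases hy : 0 < y
    swap
    · rw [Set.indicator_of_notMem (by simpa using hy)]
      simp [hy]
    have hκy : 0 < k / δ * y := by positivity
    have hs : 0 < √(k / δ * y) := Real.sqrt_pos.2 hκy
    rw [Set.indicator_of_mem (Set.mem_Ioi.2 hy)]
    simp only [Pi.mul_apply, hy, if_true]
    rw [Real.sq_sqrt hκy.le, show (k : ℝ) * y / δ = k / δ * y by ring, ← mul_assoc, ← mul_assoc,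
      ← mul_assoc,
      ← ENNReal.ofReal_mul (by positivity), ← ENNReal.ofReal_mul (by positivity),
      ← ENNReal.ofReal_mul (by positivity)]
    congr 2
    -- The Jacobian of `r = √(κ y)`, with `κ = k / δ`, times `r^{k-1}` gives the power part of the
    -- `F` density up to the factor `1/2`.
    have e1 : (k / δ) / (2 * √(k / δ * y)) * √(k / δ * y) ^ (k - 1) =
        (k / δ) ^ ((k : ℝ) / 2) * y ^ ((k : ℝ) / 2 - 1) / 2 := by
      have hy1 : y ^ ((k : ℝ) / 2 - 1) = y ^ ((k : ℝ) / 2) / y := by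
        rw [Real.rpow_sub_one hy.ne']
      have h2 : (k / δ) ^ ((k : ℝ) / 2) * y ^ ((k : ℝ) / 2) =
          √(k / δ * y) ^ (k - 1) * √(k / δ * y) := by
        rw [← pow_succ, Nat.sub_add_cancel hk, Real.sqrt_eq_rpow, ← Real.rpow_natCast,
          ← Real.rpow_mul hκy.le, ← Real.mul_rpow hκ.le hy.le]
        congr 1
        ring
      have h3 : √(k / δ * y) * √(k / δ * y) = k / δ * y := Real.mul_self_sqrt hκy.le
      rw [hy1, mul_div_assoc', h2]
      generalize √(k / δ * y) = a at *
      generalize (k : ℝ) / δ = κ at *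
      field_simp
      rw [← h3]
      ring
    rw [e1]
    field_simp
  · refine ENNReal.measurable_ofReal.comp (Measurable.ite measurableSet_Ioi ?_ measurable_const)
    fun_prop

/-! ### The scale matrix given the mean -/

section Algebra

variable {k : ℕ} {S : Matrix (Fin k) (Fin k) ℝ}

lemma isSymm_invSqrt (S : Matrix (Fin k) (Fin k) ℝ) : (invSqrt S)ᵀ = invSqrt S := by
  rw [invSqrt, transpose_nonsing_inv, isSymm_sqrt]

lemma invSqrt_mul_vecMulVec_mul (S : Matrix (Fin k) (Fin k) ℝ) (u : Fin k → ℝ) :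
    invSqrt S * vecMulVec u u * invSqrt S = vecMulVec (invSqrt S *ᵥ u) (invSqrt S *ᵥ u) := by
  rw [mul_vecMulVec, vecMulVec_mul, ← mulVec_transpose, isSymm_invSqrt]

lemma inv_eq_invSqrt_mul (hS : S.PosDef) : S⁻¹ = invSqrt S * invSqrt S := by
  rw [invSqrt, ← Matrix.mul_inv_rev, sqrt_mul_sqrt_of_posDef hS]

lemma inv_mulVec_sqrt (hS : S.PosDef) (u : Fin k → ℝ) :
    S⁻¹ *ᵥ (CFC.sqrt S *ᵥ u) = invSqrt S *ᵥ u := by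
  rw [inv_eq_invSqrt_mul hS, mulVec_mulVec, Matrix.mul_assoc, invSqrt,
    nonsing_inv_mul _ (det_sqrt_ne_zero hS).isUnit, mul_one]

lemma sqrt_dotProduct_invSqrt (hS : S.PosDef) (u v : Fin k → ℝ) :
    (CFC.sqrt S *ᵥ u) ⬝ᵥ (invSqrt S *ᵥ v) = u ⬝ᵥ v := by
  rw [dotProduct_mulVec, ← mulVec_transpose, isSymm_invSqrt, mulVec_mulVec, invSqrt,
    nonsing_inv_mul _ (det_sqrt_ne_zero hS).isUnit, one_mulVec]

lemma mulVec_invSqrt (hS : S.PosDef) (u : Fin k → ℝ) :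
    S *ᵥ (invSqrt S *ᵥ u) = CFC.sqrt S *ᵥ u := by
  nth_rw 1 [← sqrt_mul_sqrt_of_posDef hS]
  rw [mulVec_mulVec, Matrix.mul_assoc, invSqrt,
    mul_nonsing_inv _ (det_sqrt_ne_zero hS).isUnit, mul_one]

lemma upsilonFun_eq (S : Matrix (Fin k) (Fin k) ℝ) (q : ℝ) (u : Fin k → ℝ) : upsilonFun S q u =
    S⁻¹ - (q / (1 + q)) • vecMulVec (invSqrt S *ᵥ u) (invSqrt S *ᵥ u) := by
  rw [upsilonFun, invSqrt_mul_vecMulVec_mul]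

/-- Sherman–Morrison: the vector `a = S^{1/2} u` satisfies `aᵀ S⁻¹ a = 1`, whence the denominator `1
+ q`. -/
lemma inv_rankOne_update (hS : S.PosDef) {q : ℝ} (hq : 0 ≤ q) {u : Fin k → ℝ} (hu : u ⬝ᵥ u = 1) :
    (S + q • vecMulVec (CFC.sqrt S *ᵥ u) (CFC.sqrt S *ᵥ u))⁻¹ = upsilonFun S q u := by
  refine inv_eq_right_inv ?_
  have h1 : S * S⁻¹ = 1 := mul_nonsing_inv _ hS.det_pos.ne'.isUnit
  have hsym : (S⁻¹)ᵀ = S⁻¹ := by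
    rw [transpose_nonsing_inv, (isHermitian_iff_isSymm.1 hS.1).eq]
  rw [upsilonFun_eq, Matrix.add_mul, Matrix.mul_sub, Matrix.mul_sub, h1, Matrix.mul_smul,
    mul_vecMulVec, mulVec_invSqrt hS, Matrix.smul_mul, Matrix.smul_mul, vecMulVec_mul,
    ← mulVec_transpose, hsym, inv_mulVec_sqrt hS, Matrix.mul_smul, vecMulVec_mul_vecMulVec,
    sqrt_dotProduct_invSqrt hS, hu]
  ext i j
  simp
  field_simp
  ring

/-- Pull `S^{1/2}` out on both sides and apply the matrix determinant lemma to `1 + q u uᵀ`. -/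
lemma det_rankOne_update (hS : S.PosDef) (q : ℝ) {u : Fin k → ℝ} (hu : u ⬝ᵥ u = 1) :
    (S + q • vecMulVec (CFC.sqrt S *ᵥ u) (CFC.sqrt S *ᵥ u)).det = S.det * (1 + q) := by
  have : S + q • vecMulVec (CFC.sqrt S *ᵥ u) (CFC.sqrt S *ᵥ u) =
      CFC.sqrt S * (1 + vecMulVec (q • u) u) * CFC.sqrt S := by
    rw [Matrix.mul_add, Matrix.add_mul, mul_one, sqrt_mul_sqrt_of_posDef hS, smul_vecMulVec,
      Matrix.mul_smul, Matrix.smul_mul, mul_vecMulVec, vecMulVec_mul, ← mulVec_transpose,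
      isSymm_sqrt]
  rw [this, det_mul, det_mul, mul_right_comm, ← det_mul, sqrt_mul_sqrt_of_posDef hS,
    vecMulVec_eq Unit, det_one_add_replicateCol_mul_replicateRow]
  simp [hu]

/-- Here `b + N^{-1/2} r S^{1/2} u` is `μ - ρ` in polar coordinates. Since `Υ S^{1/2} u = S^{-1/2} u
/ (1 + r²)`, the coefficient `√q / (1 + q)` appears with `q = r²`. -/
lemma upsilonFun_mulVec (hS : S.PosDef) {N r : ℝ} (hr : 0 ≤ r) {u : Fin k → ℝ} (hu : u ⬝ᵥ u = 1)
    (b : Fin k → ℝ) : upsilonFun S (r ^ 2) u *ᵥ (b + (√N)⁻¹ • r • (CFC.sqrt S *ᵥ u)) =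
      zetaFun b S N (r ^ 2) u := by
  have h (x : Fin k → ℝ) : vecMulVec (invSqrt S *ᵥ u) (invSqrt S *ᵥ u) *ᵥ x =
      ((invSqrt S *ᵥ u) ⬝ᵥ x) • (invSqrt S *ᵥ u) := by
    rw [vecMulVec_mulVec]; simp
  rw [upsilonFun_eq, zetaFun, invSqrt_mul_vecMulVec_mul, h, sub_mulVec, smul_mulVec, h,
    mulVec_add, mulVec_smul, mulVec_smul, inv_mulVec_sqrt hS, dotProduct_add, dotProduct_smul,
    dotProduct_smul, dotProduct_comm _ (CFC.sqrt S *ᵥ u), sqrt_dotProduct_invSqrt hS, hu,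
    Real.sqrt_sq hr]
  have : 1 + r ^ 2 ≠ 0 := by positivity
  ext i
  simp
  field_simp
  ring

lemma dotProduct_zetaFun (hS : S.PosDef) {N r : ℝ} (hN : 0 < N) (hr : 0 ≤ r) {u : Fin k → ℝ}
    (hu : u ⬝ᵥ u = 1) (b : Fin k → ℝ) :
    (b + (√N)⁻¹ • r • (CFC.sqrt S *ᵥ u)) ⬝ᵥ zetaFun b S N (r ^ 2) u =
      epsilonFun b S N (r ^ 2) u := by
  have h (x : Fin k → ℝ) : vecMulVec (invSqrt S *ᵥ u) (invSqrt S *ᵥ u) *ᵥ x =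
      ((invSqrt S *ᵥ u) ⬝ᵥ x) • (invSqrt S *ᵥ u) := by
    rw [vecMulVec_mulVec]; simp
  have hsym : (S⁻¹)ᵀ = S⁻¹ := by
    rw [transpose_nonsing_inv, (isHermitian_iff_isSymm.1 hS.1).eq]
  have h2 : (CFC.sqrt S *ᵥ u) ⬝ᵥ (S⁻¹ *ᵥ b) = b ⬝ᵥ (invSqrt S *ᵥ u) := by
    rw [dotProduct_mulVec, ← mulVec_transpose, hsym, inv_mulVec_sqrt hS, dotProduct_comm]
  have hs : √N ^ 2 = N := Real.sq_sqrt hN.le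
  have hs0 : 0 < √N := Real.sqrt_pos.2 hN
  have h3 : 1 + r ^ 2 ≠ 0 := by positivity
  rw [zetaFun, epsilonFun, invSqrt_mul_vecMulVec_mul, h]
  simp only [dotProduct_add, dotProduct_sub, add_dotProduct, smul_dotProduct, dotProduct_smul,
    smul_eq_mul, h2, sqrt_dotProduct_invSqrt hS, hu, Real.sqrt_sq hr,
    dotProduct_comm (invSqrt S *ᵥ u) b]
  generalize b ⬝ᵥ (invSqrt S *ᵥ u) = β
  generalize √N = ν at *
  subst hs
  field_simp
  ring

end Algebra

/-- The representation for a scale matrix `A` and a vector `v`. -/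
def conditionalRep {k p : ℕ} (L : Matrix (Fin p) (Fin k) ℝ) (A : Matrix (Fin k) (Fin k) ℝ)
    (v : Fin k → ℝ) (w : ℝ) (z : Fin p → ℝ) : Fin p → ℝ :=
  w • (L *ᵥ (A⁻¹ *ᵥ v)) + √w • (CFC.sqrt ((v ⬝ᵥ (A⁻¹ *ᵥ v)) • (L * A⁻¹ * Lᵀ) -
    L * vecMulVec (A⁻¹ *ᵥ v) (A⁻¹ *ᵥ v) * Lᵀ) *ᵥ z)

lemma representation_smul {k p : ℕ} (C : ℝ) (L : Matrix (Fin p) (Fin k) ℝ) (b : Fin k → ℝ)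
    (S : Matrix (Fin k) (Fin k) ℝ) (N η : ℝ) (z : Fin p → ℝ) (q : ℝ) (u : Fin k → ℝ) :
    representation C L b S N η z q u = C • representation 1 L b S N η z q u := by
  simp only [representation, smul_add, smul_smul, one_mul]

lemma conditionalRep_eq_representation {k p : ℕ} {S : Matrix (Fin k) (Fin k) ℝ} (hS : S.PosDef)
    {N r : ℝ} (hN : 0 < N) (hr : 0 ≤ r) {u : Fin k → ℝ} (hu : u ⬝ᵥ u = 1)
    (L : Matrix (Fin p) (Fin k) ℝ) (b : Fin k → ℝ) (w : ℝ) (z : Fin p → ℝ) :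
    conditionalRep L (S + r ^ 2 • vecMulVec (CFC.sqrt S *ᵥ u) (CFC.sqrt S *ᵥ u))
      (b + (√N)⁻¹ • r • (CFC.sqrt S *ᵥ u)) w z = representation 1 L b S N w z (r ^ 2) u := by
  rw [conditionalRep, inv_rankOne_update hS (sq_nonneg r) hu, upsilonFun_mulVec hS hr hu,
    dotProduct_zetaFun hS hN hr hu, representation, one_mul, one_mul]

/-! ### Measurability of the representation -/

section Measurability

variable {α : Type*} [MeasurableSpace α] {k p : ℕ}

lemma measurable_vecMulVec_apply {v w : α → Fin k → ℝ} (hv : Measurable v) (hw : Measurable w)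
    (i j : Fin k) : Measurable fun a => vecMulVec (v a) (w a) i j := by
  simp only [vecMulVec_apply]
  exact ((measurable_pi_apply i).comp hv).mul ((measurable_pi_apply j).comp hw)

lemma measurable_sandwich_apply (L : Matrix (Fin p) (Fin k) ℝ)
    {V : α → Matrix (Fin k) (Fin k) ℝ} (hV : ∀ i j, Measurable fun a => V a i j)
    (i j : Fin p) : Measurable fun a => (L * V a * Lᵀ) i j :=
  measurable_mul_apply (measurable_mul_apply (M := fun _ => L) (fun _ _ => measurable_const) hV)
    (N := fun _ => Lᵀ) (fun _ _ => measurable_const) i j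

lemma measurable_gaussianForm (L : Matrix (Fin p) (Fin k) ℝ)
    {V : α → Matrix (Fin k) (Fin k) ℝ} (hV : ∀ i j, Measurable fun a => V a i j)
    {ζ : α → Fin k → ℝ} (hζ : Measurable ζ) {ε : α → ℝ} (hε : Measurable ε) {w w' : α → ℝ}
    (hw : Measurable w) (hw' : Measurable w') {z : α → Fin p → ℝ} (hz : Measurable z) :
    Measurable fun a => w a • (L *ᵥ ζ a) + w' a • (CFC.sqrt (ε a • (L * V a * Lᵀ) -
      L * vecMulVec (ζ a) (ζ a) * Lᵀ) *ᵥ z a) := by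
  refine (hw.smul (measurable_mulVec (M := fun _ => L) (fun _ _ => measurable_const) hζ)).add
    (hw'.smul (measurable_mulVec (measurable_sqrt_apply fun i j => ?_) hz))
  simp only [Matrix.sub_apply, Matrix.smul_apply, smul_eq_mul]
  exact (hε.mul (measurable_sandwich_apply L hV i j)).sub
    (measurable_sandwich_apply L (measurable_vecMulVec_apply hζ hζ) i j)

lemma measurable_conditionalRep (L : Matrix (Fin p) (Fin k) ℝ)
    {A : α → Matrix (Fin k) (Fin k) ℝ} (hA : ∀ i j, Measurable fun a => A a i j)
    {v : α → Fin k → ℝ} (hv : Measurable v) {w : α → ℝ} (hw : Measurable w)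
    {z : α → Fin p → ℝ} (hz : Measurable z) :
    Measurable fun a => conditionalRep L (A a) (v a) (w a) (z a) := by
  have hζ := measurable_mulVec (measurable_inv_apply hA) hv
  exact measurable_gaussianForm L (measurable_inv_apply hA) hζ (measurable_dotProduct hv hζ) hw
    hw.sqrt hz

lemma measurable_representation (C : ℝ) (L : Matrix (Fin p) (Fin k) ℝ) (b : Fin k → ℝ)
    (S : Matrix (Fin k) (Fin k) ℝ) (N : ℝ) {w : α → ℝ} (hw : Measurable w)
    {z : α → Fin p → ℝ} (hz : Measurable z) {q : α → ℝ} (hq : Measurable q)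
    {u : α → Fin k → ℝ} (hu : Measurable u) :
    Measurable fun a => representation C L b S N (w a) (z a) (q a) (u a) := by
  have hq1 : Measurable fun a => q a / (1 + q a) := hq.div (hq.const_add 1)
  have hq2 : Measurable fun a => √(q a) / (1 + q a) := hq.sqrt.div (hq.const_add 1)
  have hRu : Measurable fun a => invSqrt S *ᵥ u a :=
    measurable_mulVec (M := fun _ => invSqrt S) (fun _ _ => measurable_const) hu
  have hbu : Measurable fun a => b ⬝ᵥ (invSqrt S *ᵥ u a) :=
    measurable_dotProduct measurable_const hRu
  have hV (i j : Fin k) : Measurable fun a => upsilonFun S (q a) (u a) i j := by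
    simp only [upsilonFun_eq, Matrix.sub_apply, Matrix.smul_apply, smul_eq_mul]
    exact measurable_const.sub (hq1.mul (measurable_vecMulVec_apply hRu hRu i j))
  have hζ : Measurable fun a => zetaFun b S N (q a) (u a) := by
    simp only [zetaFun, invSqrt_mul_vecMulVec_mul]
    exact (measurable_const.add ((hq2.const_mul _).smul hRu)).sub (hq1.smul
      (measurable_mulVec (measurable_vecMulVec_apply hRu hRu) measurable_const))
  have hε : Measurable fun a => epsilonFun b S N (q a) (u a) := by
    simp only [epsilonFun]
    exact ((measurable_const.add ((hq2.const_mul _).mul hbu)).add (hq1.const_mul _)).sub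
      (hq1.mul (hbu.pow_const 2))
  exact measurable_gaussianForm L hV hζ hε (hw.const_mul C) (hw.sqrt.const_mul C) hz

end Measurability

/-! ### The normal inverse Wishart law -/

lemma lintegral_toSphere {k : ℕ} (hk : 0 < k) (G : UnitSphere k → ℝ≥0∞) :
    ∫⁻ u, G u ∂(volume : Measure (EuclideanSpace ℝ (Fin k))).toSphere =
      (volume : Measure (EuclideanSpace ℝ (Fin k))).toSphere Set.univ *
        ∫⁻ u, G u ∂uniformSphere k := by
  have : Nonempty (Fin k) := ⟨⟨0, hk⟩⟩
  have h0 : (volume : Measure (EuclideanSpace ℝ (Fin k))).toSphere Set.univ ≠ 0 := by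
    rw [Measure.measure_univ_ne_zero]
    exact Measure.toSphere_ne_zero _
  rw [uniformSphere, lintegral_smul_measure, smul_eq_mul, ← mul_assoc,
    ENNReal.mul_inv_cancel h0 (measure_ne_top _ _), one_mul]

instance sFinite_fisherF (d₁ d₂ : ℝ) : SFinite (fisherF d₁ d₂) := by
  unfold fisherF; infer_instance

instance sFinite_chiSq (ν : ℝ) : SFinite (chiSq ν) := by
  unfold chiSq gammaMeasure; infer_instance

instance sFinite_uniformSphere (k : ℕ) : SFinite (uniformSphere k) := by
  unfold uniformSphere; infer_instance

/-- Tonelli, in the order of the disintegration: `u` and `Q` describe `μ` and stay outside, `η` and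
`z₀` describe `Σ` given `μ`. -/
lemma lintegral_driverLaw {p k : ℕ} {ν d : ℝ}
    {G : ℝ → EuclideanSpace ℝ (Fin p) → ℝ → UnitSphere k → ℝ≥0∞}
    (hG : Measurable fun a : ℝ × EuclideanSpace ℝ (Fin p) × ℝ × UnitSphere k =>
      G a.1 a.2.1 a.2.2.1 a.2.2.2) :
    ∫⁻ a, G a.1 a.2.1 a.2.2.1 a.2.2.2 ∂driverLaw p k ν d =
      ∫⁻ u, ∫⁻ y, ∫⁻ w, ∫⁻ z, G w z y u ∂stdGaussian (EuclideanSpace ℝ (Fin p)) ∂chiSq ν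
        ∂fisherF k d ∂uniformSphere k := by
  rw [driverLaw, lintegral_prod _ hG.aemeasurable]
  have h1 (w : ℝ) : ∫⁻ a, G w a.1 a.2.1 a.2.2 ∂((stdGaussian (EuclideanSpace ℝ (Fin p))).prod
      ((fisherF k d).prod (uniformSphere k))) =
      ∫⁻ b, ∫⁻ z, G w z b.1 b.2 ∂stdGaussian (EuclideanSpace ℝ (Fin p))
        ∂((fisherF k d).prod (uniformSphere k)) :=
    lintegral_prod_symm _ (hG.comp measurable_prodMk_left).aemeasurable
  simp only [h1]
  have hG1 : Measurable fun a : (ℝ × UnitSphere k) × ℝ =>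
      ∫⁻ z, G a.2 z a.1.1 a.1.2 ∂stdGaussian (EuclideanSpace ℝ (Fin p)) := by
    refine Measurable.lintegral_prod_right' (f := fun c : ((ℝ × UnitSphere k) × ℝ) ×
      EuclideanSpace ℝ (Fin p) => G c.1.2 c.2 c.1.1.1 c.1.1.2) ?_
    exact hG.comp (g := fun a : ℝ × EuclideanSpace ℝ (Fin p) × ℝ × UnitSphere k =>
      G a.1 a.2.1 a.2.2.1 a.2.2.2) (f := fun c : ((ℝ × UnitSphere k) × ℝ) ×
      EuclideanSpace ℝ (Fin p) => (c.1.2, c.2, c.1.1.1, c.1.1.2)) (by fun_prop)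
  rw [lintegral_lintegral_swap (f := fun w (b : ℝ × UnitSphere k) =>
    ∫⁻ z, G w z b.1 b.2 ∂stdGaussian (EuclideanSpace ℝ (Fin p)))
    (hG1.comp measurable_swap).aemeasurable]
  exact lintegral_prod_symm _ (Measurable.lintegral_prod_right' hG1).aemeasurable

lemma posDef_add_smul_vecMulVec {k : ℕ} {S : Matrix (Fin k) (Fin k) ℝ} (hS : S.PosDef) {N : ℝ}
    (hN : 0 ≤ N) (v : Fin k → ℝ) : (S + N • vecMulVec v v).PosDef :=
  hS.add_posSemidef ((posSemidef_vecMulVec_self_star v).smul hN)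

/-- The law of `L Σ⁻¹ (μ - ρ)` under the weight
`|Σ|^{-(d+1)/2} exp(-(N (μ-m)ᵀ Σ⁻¹ (μ-m) + tr(Σ⁻¹ S))/2)`. -/
lemma exists_lintegral_normalInverseWishart {k p : ℕ} (hk : 0 < k) {d : ℝ}
    (hd : 2 * (k : ℝ) < d) {S : Matrix (Fin k) (Fin k) ℝ} (hS : S.PosDef) {N : ℝ} (hN : 0 < N)
    (m ρ : Fin k → ℝ) (L : Matrix (Fin p) (Fin k) ℝ) :
    ∃ c : ℝ≥0∞, c ≠ 0 ∧ c ≠ ∞ ∧ ∀ f : (Fin p → ℝ) → ℝ≥0∞, Measurable f →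
      ∫⁻ θ : Param k, iwWeight d (S + N • vecMulVec (θ.1 - m) (θ.1 - m)) (symMatrix θ.2) *
          f (L *ᵥ ((symMatrix θ.2)⁻¹ *ᵥ (θ.1 - ρ))) =
        c * ∫⁻ a, f (representation 1 L (m - ρ) S N a.1 a.2.1.ofLp
          (k * a.2.2.1 / (d - 2 * k)) a.2.2.2.1.ofLp) ∂driverLaw p k (d - k) (d - 2 * k) := by
  have : Nonempty (Fin k) := ⟨⟨0, hk⟩⟩
  obtain ⟨c₀, hc₀, hc₀', H₀⟩ := exists_lintegral_iwWeight_inv_mulVec hk hd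
  obtain ⟨c₂, hc₂, hc₂', H₂⟩ := exists_lintegral_fisherF hk (sub_pos.2 hd)
  -- Whitening map for `μ - m`: it turns `N (μ-m)(μ-m)ᵀ` into `r² S^{1/2} u uᵀ S^{1/2}` at the point
  -- `r u`.
  set T : Matrix (Fin k) (Fin k) ℝ := (√N)⁻¹ • CFC.sqrt S with hT
  have hsN : 0 < √N := Real.sqrt_pos.2 hN
  have hTdet : T.det ≠ 0 := by
    rw [hT, det_smul]
    exact mul_ne_zero (pow_ne_zero _ (inv_ne_zero hsN.ne')) (det_sqrt_ne_zero hS)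
  set cS : ℝ≥0∞ := (volume : Measure (EuclideanSpace ℝ (Fin k))).toSphere Set.univ with hcS
  have hcS0 : cS ≠ 0 := by
    rw [hcS, Measure.measure_univ_ne_zero]
    exact Measure.toSphere_ne_zero _
  have hcS' : cS ≠ ∞ := measure_ne_top _ _
  set cD : ℝ≥0∞ := ENNReal.ofReal (S.det ^ (-(d - k) / 2)) with hcD
  have hcD0 : cD ≠ 0 := by
    have := hS.det_pos
    rw [hcD, ENNReal.ofReal_ne_zero_iff]
    positivity
  have hcD' : cD ≠ ∞ := ENNReal.ofReal_ne_top
  have hcT0 : ENNReal.ofReal |T.det| ≠ 0 := by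
    rw [ENNReal.ofReal_ne_zero_iff]
    exact abs_pos.2 hTdet
  refine ⟨c₀ * (ENNReal.ofReal |T.det| * (cS * (cD * c₂))),
    mul_ne_zero hc₀ (mul_ne_zero hcT0 (mul_ne_zero hcS0 (mul_ne_zero hcD0 hc₂))),
    ENNReal.mul_ne_top hc₀' (ENNReal.mul_ne_top ENNReal.ofReal_ne_top
      (ENNReal.mul_ne_top hcS' (ENNReal.mul_ne_top hcD' hc₂'))), fun f hf => ?_⟩
  have hAm {α : Type} [MeasurableSpace α] {v : α → Fin k → ℝ} (hv : Measurable v) (i j : Fin k) :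
      Measurable fun a => (S + N • vecMulVec (v a) (v a)) i j := by
    simp only [Matrix.add_apply, Matrix.smul_apply, smul_eq_mul]
    exact ((measurable_vecMulVec_apply hv hv i j).const_mul N).const_add _
  -- Up to the constant `c₀`, this is the unnormalized marginal density of `v = μ - m` times the
  -- conditional expectation of `f` given `μ`.
  set Φ : (Fin k → ℝ) → ℝ≥0∞ := fun v =>
    ENNReal.ofReal ((S + N • vecMulVec v v).det ^ (-(d - k) / 2)) *
      ∫⁻ w, ∫⁻ z, f (conditionalRep L (S + N • vecMulVec v v) (m - ρ + v) w z.ofLp)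
        ∂stdGaussian (EuclideanSpace ℝ (Fin p)) ∂chiSq (d - k) with hΦ
  have hΦm : Measurable Φ := by
    refine ((measurable_det_apply (hAm measurable_id)).pow_const _).ennreal_ofReal.mul ?_
    have h3 : Measurable fun a : ((Fin k → ℝ) × ℝ) × EuclideanSpace ℝ (Fin p) =>
        f (conditionalRep L (S + N • vecMulVec a.1.1 a.1.1) (m - ρ + a.1.1) a.1.2 a.2.ofLp) :=
      hf.comp (measurable_conditionalRep L (hAm (by fun_prop)) (by fun_prop) (by fun_prop)
        (by fun_prop))
    exact Measurable.lintegral_prod_right' (Measurable.lintegral_prod_right' h3)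
  have hjoint : Measurable fun θ : Param k =>
      iwWeight d (S + N • vecMulVec (θ.1 - m) (θ.1 - m)) (symMatrix θ.2) *
        f (L *ᵥ ((symMatrix θ.2)⁻¹ *ᵥ (θ.1 - ρ))) := by
    refine (measurable_iwWeight_comp d (hAm (measurable_fst.sub_const m)) measurable_snd).mul
      (hf.comp ?_)
    refine measurable_mulVec (M := fun _ => L) (fun _ _ => measurable_const)
      (measurable_mulVec (measurable_inv_apply fun i j => ?_) (measurable_fst.sub_const ρ))
    exact (measurable_symMatrix_apply i j).comp measurable_snd
  set Γ : ℝ → UnitSphere k → ℝ≥0∞ := fun q u =>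
    ∫⁻ w, ∫⁻ z, f (representation 1 L (m - ρ) S N w z.ofLp q u.1.ofLp)
      ∂stdGaussian (EuclideanSpace ℝ (Fin p)) ∂chiSq (d - k) with hΓ
  have hΓm (u : UnitSphere k) : Measurable fun q => Γ q u := by
    have h3 : Measurable fun a : (ℝ × ℝ) × EuclideanSpace ℝ (Fin p) =>
        f (representation 1 L (m - ρ) S N a.1.2 a.2.ofLp a.1.1 u.1.ofLp) :=
      hf.comp (measurable_representation 1 L _ S N (by fun_prop) (by fun_prop) (by fun_prop)
        measurable_const)
    exact Measurable.lintegral_prod_right' (Measurable.lintegral_prod_right' h3)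
  -- In polar coordinates the marginal weight depends on `r` alone. The exponent `d - k` is written
  -- `k + (d - 2k)` to display the degrees of freedom of the `F` law.
  have hpolar (u : UnitSphere k) (r : ℝ) (hr : 0 < r) : Φ (T *ᵥ (r • u.1).ofLp) =
      cD * (ENNReal.ofReal ((1 + r ^ 2) ^ (-(k + (d - 2 * k)) / 2)) * Γ (r ^ 2) u) := by
    have hu : u.1.ofLp ⬝ᵥ u.1.ofLp = 1 := by
      rw [← norm_sq_eq_dotProduct, norm_eq_of_mem_sphere u, one_pow]
    have hv : T *ᵥ (r • u.1).ofLp = (√N)⁻¹ • r • (CFC.sqrt S *ᵥ u.1.ofLp) := by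
      rw [hT, smul_mulVec, WithLp.ofLp_smul, mulVec_smul]
    have hvv : N • vecMulVec (T *ᵥ (r • u.1).ofLp) (T *ᵥ (r • u.1).ofLp) =
        r ^ 2 • vecMulVec (CFC.sqrt S *ᵥ u.1.ofLp) (CFC.sqrt S *ᵥ u.1.ofLp) := by
      rw [hv]
      simp only [smul_vecMulVec, vecMulVec_smul, smul_smul]
      congr 1
      have : √N ^ 2 = N := Real.sq_sqrt hN.le
      nth_rw 1 [← this]
      field_simp
    simp only [hΦ, hΓ]
    rw [hvv, hv, det_rankOne_update hS _ hu, Real.mul_rpow hS.det_pos.le (by positivity),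
      ENNReal.ofReal_mul (by have := hS.det_pos; positivity), mul_assoc]
    simp only [conditionalRep_eq_representation hS hN hr.le hu]
    rw [show (k : ℝ) + (d - 2 * k) = d - k by ring]
  calc _ = ∫⁻ μ, c₀ * Φ (μ - m) := by
        rw [Measure.volume_eq_prod, lintegral_prod _ hjoint.aemeasurable]
        refine lintegral_congr fun μ => ?_
        have hA := posDef_add_smul_vecMulVec hS hN.le (μ - m)
        have e := H₀ hA L (μ - ρ) f hf
        simp only [hΦ, conditionalRep, sub_add_sub_cancel']
        exact e
    _ = c₀ * ∫⁻ v, Φ v := by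
        rw [lintegral_const_mul' _ _ hc₀', lintegral_sub_right_eq_self (fun v => Φ v) m]
    _ = c₀ * (ENNReal.ofReal |T.det| * ∫⁻ y : EuclideanSpace ℝ (Fin k), Φ (T *ᵥ y.ofLp)) := by
        rw [lintegral_comp_mulVec hTdet hΦm]
        congr 2
        exact ((PiLp.volume_preserving_ofLp (Fin k)).lintegral_comp (f := fun y => Φ (T *ᵥ y))
          (hΦm.comp (measurable_mulVec (M := fun _ => T) (fun _ _ => measurable_const)
            measurable_id))).symm
    _ = c₀ * (ENNReal.ofReal |T.det| * ∫⁻ u, cD * (c₂ * ∫⁻ y, Γ (k * y / (d - 2 * k)) u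
          ∂fisherF k (d - 2 * k)) ∂(volume : Measure (EuclideanSpace ℝ (Fin k))).toSphere) := by
        congr 2
        rw [lintegral_polar hk (hΦm.fun_comp (measurable_mulVec (M := fun _ => T)
          (fun _ _ => measurable_const) (WithLp.measurable_ofLp 2 _)))]
        refine lintegral_congr fun u => ?_
        rw [← H₂ _ (hΓm u), ← lintegral_const_mul' _ _ hcD']
        refine setLIntegral_congr_fun measurableSet_Ioi fun r hr => ?_
        rw [hpolar u r hr, mul_left_comm]
    _ = _ := by
        rw [lintegral_const_mul' _ _ hcD', lintegral_const_mul' _ _ hc₂', lintegral_toSphere hk,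
          lintegral_driverLaw (G := fun w z y u => f (representation 1 L (m - ρ) S N w z.ofLp
            (k * y / (d - 2 * k)) u.1.ofLp))]
        · simp only [hΓ]
          ring
        · exact hf.comp (measurable_representation 1 L _ S N (by fun_prop) (by fun_prop)
            (by fun_prop) (by fun_prop))

/-! ### The posterior density -/

section Posterior

variable {k n : ℕ}

lemma dotProduct_mulVec_eq_trace (P : Matrix (Fin k) (Fin k) ℝ) (v : Fin k → ℝ) :
    v ⬝ᵥ (P *ᵥ v) = (P * vecMulVec v v).trace := by
  rw [mul_vecMulVec, trace_vecMulVec, dotProduct_comm]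

/-- The factor `n - 1` cancels against its inverse because `n ≠ 1`; at `n = 1` the convention `0⁻¹ =
0` would intervene. -/
lemma scaleD_eq (hn : 1 < n) (x : Fin n → Fin k → ℝ) :
    scaleD x = ∑ i, vecMulVec (x i - sampleMean x) (x i - sampleMean x) := by
  have : (n : ℝ) - 1 ≠ 0 := by
    have : (1 : ℝ) < n := by exact_mod_cast hn
    linarith
  rw [scaleD, sampleCov, smul_smul, mul_inv_cancel₀ this, one_smul]

lemma posSemidef_scaleD (hn : 1 < n) (x : Fin n → Fin k → ℝ) : (scaleD x).PosSemidef := by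
  rw [scaleD_eq hn]
  exact posSemidef_sum _ fun i _ => posSemidef_vecMulVec_self_star _

lemma sum_vecMulVec_sub (hn : 1 < n) (x : Fin n → Fin k → ℝ) (μ : Fin k → ℝ) :
    ∑ i, vecMulVec (x i - μ) (x i - μ) =
      scaleD x + (n : ℝ) • vecMulVec (μ - sampleMean x) (μ - sampleMean x) := by
  have hn0 : (n : ℝ) ≠ 0 := by positivity
  have hmean (a : Fin k) : ∑ i, x i a = n * sampleMean x a := by
    simp [sampleMean, Finset.sum_apply, hn0]
  rw [scaleD_eq hn]
  ext a b
  simp only [Matrix.sum_apply, Matrix.add_apply, Matrix.smul_apply, vecMulVec_apply, Pi.sub_apply,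
    smul_eq_mul]
  have e (c : Fin k → ℝ) : ∑ i, (x i a - c a) * (x i b - c b) =
      ∑ i, x i a * x i b - c b * ∑ i, x i a - c a * ∑ i, x i b + n * (c a * c b) := by
    rw [Finset.mul_sum, Finset.mul_sum, ← Finset.sum_sub_distrib, ← Finset.sum_sub_distrib,
      show (n : ℝ) * (c a * c b) = ∑ _i : Fin n, c a * c b by simp, ← Finset.sum_add_distrib]
    exact Finset.sum_congr rfl fun i _ => by ring
  rw [e, e, hmean, hmean]
  ring

lemma likelihood_eq (hn : 1 < n) (x : Fin n → Fin k → ℝ) {θ : Param k} (hθ : θ.cov.PosDef) :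
    likelihood x θ = ((2 * Real.pi) ^ (-(k : ℝ) / 2)) ^ n * θ.cov.det ^ (-(n : ℝ) / 2) *
      Real.exp (-(θ.cov⁻¹ * (scaleD x +
        (n : ℝ) • vecMulVec (θ.mean - sampleMean x) (θ.mean - sampleMean x))).trace / 2) := by
  simp only [likelihood, normalDensity, Finset.prod_mul_distrib, Finset.prod_const,
    Finset.card_univ, Fintype.card_fin]
  rw [← Real.exp_sum, ← sum_vecMulVec_sub hn, ← Real.rpow_natCast (θ.cov.det ^ _),
    ← Real.rpow_mul hθ.det_pos.le]
  congr 2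
  · congr 1; ring
  · simp only [dotProduct_mulVec_eq_trace]
    rw [← Finset.sum_div, Finset.sum_neg_distrib, ← trace_sum, Matrix.mul_sum]

/-- The exponents `n/2` and `(k+1)/2` of `|Σ|⁻¹` add up to `(d+1)/2` with `d = n + k`. -/
lemma likelihood_mul_diffusePrior (hn : 1 < n) (x : Fin n → Fin k → ℝ) :
    ∃ K : ℝ, 0 < K ∧ ∀ θ : Param k, θ.cov.PosDef → likelihood x θ * diffusePrior k θ =
      K * (θ.cov.det ^ (-((n + k : ℝ) + 1) / 2) * Real.exp (-(θ.cov⁻¹ * (scaleD x +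
        (n : ℝ) • vecMulVec (θ.mean - sampleMean x) (θ.mean - sampleMean x))).trace / 2)) := by
  refine ⟨((2 * Real.pi) ^ (-(k : ℝ) / 2)) ^ n, by positivity, fun θ hθ => ?_⟩
  have h : θ.cov.det ^ (-((n + k : ℝ) + 1) / 2) =
      θ.cov.det ^ (-(n : ℝ) / 2) * θ.cov.det ^ (-((k : ℝ) + 1) / 2) := by
    rw [← Real.rpow_add hθ.det_pos]; congr 1; ring
  rw [likelihood_eq hn x hθ, diffusePrior, h]
  ring

/-- Completing the square in `μ`: the quadratic terms of the likelihood and of the prior combine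
into one centred at the posterior location, and the remainder goes into `scaleC`. -/
lemma scaleC_add (hn : 1 < n) (x : Fin n → Fin k → ℝ) (m₀ : Fin k → ℝ) {r₀ : ℝ} (hr : 0 < r₀)
    (S₀ : Matrix (Fin k) (Fin k) ℝ) (μ : Fin k → ℝ) :
    scaleC x m₀ r₀ S₀ + ((n : ℝ) + r₀) • vecMulVec (μ - meanC x m₀ r₀) (μ - meanC x m₀ r₀) =
      (scaleD x + (n : ℝ) • vecMulVec (μ - sampleMean x) (μ - sampleMean x)) +
        r₀ • vecMulVec (μ - m₀) (μ - m₀) + S₀ := by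
  have hnr : (n : ℝ) + r₀ ≠ 0 := by positivity
  ext a b
  simp only [scaleC, meanC, Matrix.add_apply, Matrix.smul_apply, vecMulVec_apply, Pi.sub_apply,
    Pi.smul_apply, Pi.add_apply, smul_eq_mul]
  field_simp
  ring

/-- The exponents `n/2`, `1/2` (normal prior of `μ`) and `d₀/2` of `|Σ|⁻¹` add up to `(d+1)/2` with
`d = n + d₀`. -/
lemma likelihood_mul_conjugatePrior (hn : 1 < n) (x : Fin n → Fin k → ℝ) (m₀ : Fin k → ℝ)
    {r₀ d₀ : ℝ} (hr : 0 < r₀) (hd : 2 * (k : ℝ) < d₀) {S₀ : Matrix (Fin k) (Fin k) ℝ}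
    (hS₀ : S₀.PosDef) :
    ∃ K : ℝ, 0 < K ∧ ∀ θ : Param k, θ.cov.PosDef →
      likelihood x θ * conjugatePrior m₀ r₀ d₀ S₀ θ =
        K * (θ.cov.det ^ (-((n + d₀ : ℝ) + 1) / 2) *
          Real.exp (-(θ.cov⁻¹ * (scaleC x m₀ r₀ S₀ + ((n : ℝ) + r₀) •
            vecMulVec (θ.mean - meanC x m₀ r₀) (θ.mean - meanC x m₀ r₀))).trace / 2)) := by
  -- The gamma arguments are `(d₀ - k - 1 - i)/2` with `i + 1 ≤ k`, hence positive because `d₀ >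
  -- 2k`.
  have hΓ : 0 < multivariateGamma k ((d₀ - k - 1) / 2) := by
    refine mul_pos (by positivity) (Finset.prod_pos fun i _ => Real.Gamma_pos_of_pos ?_)
    have : ((i : ℕ) : ℝ) + 1 ≤ k := by exact_mod_cast i.2
    linarith
  have hdet := hS₀.det_pos
  refine ⟨((2 * Real.pi) ^ (-(k : ℝ) / 2)) ^ n * ((2 * Real.pi) ^ (-(k : ℝ) / 2) *
    (r₀⁻¹ ^ k) ^ (-(1 : ℝ) / 2) * (S₀.det ^ ((d₀ - k - 1) / 2) /
      (2 ^ ((d₀ - k - 1) * k / 2) * multivariateGamma k ((d₀ - k - 1) / 2)))),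
    by positivity, fun θ hθ => ?_⟩
  have hinv : (r₀⁻¹ • θ.cov)⁻¹ = r₀ • θ.cov⁻¹ := by
    refine inv_eq_right_inv ?_
    rw [Matrix.smul_mul, Matrix.mul_smul, smul_smul, inv_mul_cancel₀ hr.ne', one_smul,
      mul_nonsing_inv _ hθ.det_pos.ne'.isUnit]
  have h : θ.cov.det ^ (-((n + d₀ : ℝ) + 1) / 2) = θ.cov.det ^ (-(n : ℝ) / 2) *
      (θ.cov.det ^ (-(1 : ℝ) / 2) * θ.cov.det ^ (-d₀ / 2)) := by
    rw [← Real.rpow_add hθ.det_pos, ← Real.rpow_add hθ.det_pos]; congr 1; ring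
  have hq : (θ.mean - m₀) ⬝ᵥ ((r₀ • θ.cov⁻¹) *ᵥ (θ.mean - m₀)) =
      (θ.cov⁻¹ * (r₀ • vecMulVec (θ.mean - m₀) (θ.mean - m₀))).trace := by
    rw [dotProduct_mulVec_eq_trace, Matrix.smul_mul, Matrix.mul_smul]
  have hexp (a b c : ℝ) : Real.exp (-(a + b + c) / 2) =
      Real.exp (-a / 2) * Real.exp (-b / 2) * Real.exp (-c / 2) := by
    rw [← Real.exp_add, ← Real.exp_add]; congr 1; ring
  rw [scaleC_add hn x m₀ hr, Matrix.mul_add, Matrix.mul_add, trace_add, trace_add, hexp,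
    likelihood_eq hn x hθ, conjugatePrior, normalDensity, invWishartDensity, hinv, hq, h,
    det_smul, Fintype.card_fin, Real.mul_rpow (by positivity) hθ.det_pos.le]
  ring

lemma posDef_scaleC (hn : 1 < n) (x : Fin n → Fin k → ℝ) (m₀ : Fin k → ℝ) {r₀ : ℝ} (hr : 0 < r₀)
    {S₀ : Matrix (Fin k) (Fin k) ℝ} (hS₀ : S₀.PosDef) : (scaleC x m₀ r₀ S₀).PosDef :=
  posDef_add_smul_vecMulVec (hS₀.posSemidef_add (posSemidef_scaleD hn x)) (by positivity) _

lemma measurableSet_posDef_cov : MeasurableSet {θ : Param k | θ.cov.PosDef} :=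
  measurable_snd measurableSet_posDef_symMatrix

lemma measurable_mulVec_weights {p : ℕ} (L : Matrix (Fin p) (Fin k) ℝ) (γ W : ℝ) (rf : ℕ → ℝ)
    (t T : ℕ) : Measurable fun θ : Param k => L *ᵥ weights γ W rf t T θ := by
  have h : Measurable fun θ : Param k => (symMatrix θ.2)⁻¹ *ᵥ (θ.1 - fun _ => rf (t + 1)) :=
    measurable_mulVec (measurable_inv_apply fun i j =>
      (measurable_symMatrix_apply i j).comp measurable_snd) (measurable_fst.sub_const _)
  have hw : Measurable fun θ : Param k => weights γ W rf t T θ :=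
    h.const_smul (portfolioConst γ W rf t T)
  exact measurable_mulVec (M := fun _ => L) (fun _ _ => measurable_const) hw

/-- A posterior density proportional to a normal inverse Wishart density yields the stochastic
representation of the portfolio weights. -/
lemma identDistrib_of_density {p : ℕ} (hk : 0 < k) {d : ℝ} (hd : 2 * (k : ℝ) < d)
    {S : Matrix (Fin k) (Fin k) ℝ} (hS : S.PosDef) {N : ℝ} (hN : 0 < N) (m : Fin k → ℝ)
    (x : Fin n → Fin k → ℝ) {prior : Param k → ℝ}
    (hprior : ∃ K : ℝ, 0 < K ∧ ∀ θ : Param k, θ.cov.PosDef → likelihood x θ * prior θ =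
      K * (θ.cov.det ^ (-(d + 1) / 2) * Real.exp (-(θ.cov⁻¹ * (S +
        N • vecMulVec (θ.mean - m) (θ.mean - m))).trace / 2)))
    (L : Matrix (Fin p) (Fin k) ℝ) (γ W : ℝ) (rf : ℕ → ℝ) (t T : ℕ)
    {Ω : Type*} [MeasurableSpace Ω] {P : Measure Ω} [IsProbabilityMeasure P]
    {η : Ω → ℝ} {z₀ : Ω → EuclideanSpace ℝ (Fin p)} {Q : Ω → ℝ} {u : Ω → UnitSphere k}
    (hX : HasLaw (fun ω => (η ω, z₀ ω, Q ω, u ω)) (driverLaw p k (d - k) (d - 2 * k)) P) :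
    IdentDistrib (fun θ => L *ᵥ weights γ W rf t T θ)
      (fun ω => representation (portfolioConst γ W rf t T) L (m - fun _ => rf (t + 1)) S N
        (η ω) (z₀ ω).ofLp (k * Q ω / (d - 2 * k)) (u ω).1.ofLp)
      (posteriorDist prior x) P := by
  obtain ⟨K, hK, hdens⟩ := hprior
  obtain ⟨c, hc, hc', hNIW⟩ :=
    exists_lintegral_normalInverseWishart hk hd hS hN m (fun _ => rf (t + 1)) L
  set C := portfolioConst γ W rf t T
  set g : ℝ × EuclideanSpace ℝ (Fin p) × ℝ × UnitSphere k → Fin p → ℝ := fun a =>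
    representation C L (m - fun _ => rf (t + 1)) S N a.1 a.2.1.ofLp
      (k * a.2.2.1 / (d - 2 * k)) a.2.2.2.1.ofLp with hg
  have hgm : Measurable g := measurable_representation C L _ S N (by fun_prop) (by fun_prop)
    (by fun_prop) (by fun_prop)
  have hwm := measurable_mulVec_weights L γ W rf t T
  set κ : ℝ≥0∞ := ENNReal.ofReal K * c with hκ
  have hκ0 : κ ≠ 0 := mul_ne_zero (ENNReal.ofReal_ne_zero_iff.2 hK) hc
  have hκ' : κ ≠ ∞ := ENNReal.mul_ne_top ENNReal.ofReal_ne_top hc'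
  set w : Param k → ℝ≥0∞ := fun θ =>
    iwWeight d (S + N • vecMulVec (θ.1 - m) (θ.1 - m)) (symMatrix θ.2) with hw
  have hwmeas : Measurable w := by
    refine measurable_iwWeight_comp d (fun i j => ?_) measurable_snd
    simp only [Matrix.add_apply, Matrix.smul_apply, smul_eq_mul]
    exact ((measurable_vecMulVec_apply (measurable_fst.sub_const m) (measurable_fst.sub_const m)
      i j).const_mul N).const_add _
  -- The weight vanishes off the positive definite cone, which absorbs the restriction of Lebesgue
  -- measure.
  have hunn : unnormalizedPosterior prior x =
      volume.withDensity fun θ => ENNReal.ofReal K * w θ := by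
    rw [unnormalizedPosterior, paramVolume, ← withDensity_indicator measurableSet_posDef_cov]
    congr 1
    ext1 θ
    by_cases hθ : θ.cov.PosDef
    · rw [Set.indicator_of_mem (by exact hθ), hdens θ hθ, ENNReal.ofReal_mul hK.le]
      simp only [hw]
      rw [iwWeight_of_posDef (M := symMatrix θ.2) hθ]
      rfl
    · rw [Set.indicator_of_notMem (by exact hθ)]
      simp only [hw]
      rw [iwWeight_of_not_posDef (M := symMatrix θ.2) hθ, mul_zero]
  have hmain (f : (Fin p → ℝ) → ℝ≥0∞) (hf : Measurable f) :
      ∫⁻ θ, f (L *ᵥ weights γ W rf t T θ) ∂unnormalizedPosterior prior x =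
        κ * ∫⁻ a, f (g a) ∂driverLaw p k (d - k) (d - 2 * k) := by
    have hw' (θ : Param k) : L *ᵥ weights γ W rf t T θ =
        C • (L *ᵥ ((symMatrix θ.2)⁻¹ *ᵥ (θ.1 - fun _ => rf (t + 1)))) := by
      rw [weights, mulVec_smul]; rfl
    rw [hunn, lintegral_withDensity_eq_lintegral_mul _ (hwmeas.const_mul _)
      (hf.fun_comp hwm)]
    simp only [Pi.mul_apply, mul_assoc, hw', hw]
    rw [lintegral_const_mul' _ _ ENNReal.ofReal_ne_top,
      hNIW (fun y => f (C • y)) (hf.comp (measurable_const_smul C)), hκ, mul_assoc]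
    simp only [hg, representation_smul C]
  have hlaw (f : (Fin p → ℝ) → ℝ≥0∞) (hf : Measurable f) :
      ∫⁻ a, f (g a) ∂driverLaw p k (d - k) (d - 2 * k) =
        ∫⁻ ω, f (g (η ω, z₀ ω, Q ω, u ω)) ∂P := by
    rw [← hX.map_eq, lintegral_map' (hf.fun_comp hgm).aemeasurable hX.aemeasurable]
  -- Testing with `f = 1` shows that the total mass is `κ`, neither `0` nor `∞`, so the normalized
  -- posterior is a genuine probability measure.
  have huniv : unnormalizedPosterior prior x Set.univ = κ := by
    have := hmain (fun _ => 1) measurable_const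
    rw [hlaw _ measurable_const] at this
    simpa using this
  refine ⟨hwm.aemeasurable, hgm.comp_aemeasurable hX.aemeasurable, ?_⟩
  have hgX : AEMeasurable (fun ω => g (η ω, z₀ ω, Q ω, u ω)) P :=
    hgm.comp_aemeasurable hX.aemeasurable
  change _ = P.map fun ω => g (η ω, z₀ ω, Q ω, u ω)
  ext B hB
  have hf : Measurable (B.indicator (1 : (Fin p → ℝ) → ℝ≥0∞)) := measurable_one.indicator hB
  have e := (hmain _ hf).trans (congrArg (κ * ·) (hlaw _ hf))
  rw [← lintegral_map hf hwm, lintegral_indicator_one hB,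
    ← lintegral_map' hf.aemeasurable hgX, lintegral_indicator_one hB] at e
  rw [posteriorDist, huniv, Measure.map_smul, Measure.smul_apply, e, smul_eq_mul, ← mul_assoc,
    ENNReal.inv_mul_cancel hκ0 hκ', one_mul]

end Posterior

end BayesPortfolio

end

/-! ### The diffuse and the conjugate prior -/

theorem theorem2 {k p n : ℕ} (hk : 0 < k) (hkn : k < n)
    (x : Fin n → Fin k → ℝ) (L : Matrix (Fin p) (Fin k) ℝ)
    (γ W : ℝ) (hγ : 0 < γ) (rf : ℕ → ℝ) (t T : ℕ) (ht : t < T)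
    {Ω : Type*} [MeasurableSpace Ω] (P : Measure Ω) [IsProbabilityMeasure P]
    (η : Ω → ℝ) (z₀ : Ω → EuclideanSpace ℝ (Fin p)) (Q : Ω → ℝ) (u : Ω → UnitSphere k) :
    -- diffuse prior
    ((scaleD x).PosDef →
      HasLaw (fun ω => (η ω, z₀ ω, Q ω, u ω)) (driverLaw p k n ((n : ℝ) - k)) P →
      IdentDistrib (fun θ => L *ᵥ weights γ W rf t T θ)
        (fun ω => representation (portfolioConst γ W rf t T) L
          (sampleMean x - fun _ => rf (t + 1)) (scaleD x) n
          (η ω) (z₀ ω).ofLp (k * Q ω / ((n : ℝ) - k)) (u ω).1.ofLp)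
        (posteriorDist (diffusePrior k) x) P) ∧
    -- conjugate prior
    (∀ (m₀ : Fin k → ℝ) (r₀ d₀ : ℝ) (S₀ : Matrix (Fin k) (Fin k) ℝ),
      0 < r₀ → 2 * (k : ℝ) < d₀ → S₀.PosDef →
      HasLaw (fun ω => (η ω, z₀ ω, Q ω, u ω))
        (driverLaw p k ((n : ℝ) + d₀ - k) ((n : ℝ) + d₀ - 2 * k)) P →
      IdentDistrib (fun θ => L *ᵥ weights γ W rf t T θ)
        (fun ω => representation (portfolioConst γ W rf t T) L
          (meanC x m₀ r₀ - fun _ => rf (t + 1)) (scaleC x m₀ r₀ S₀) ((n : ℝ) + r₀)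
          (η ω) (z₀ ω).ofLp (k * Q ω / ((n : ℝ) + d₀ - 2 * k)) (u ω).1.ofLp)
        (posteriorDist (conjugatePrior m₀ r₀ d₀ S₀) x) P) := by
  have hn : 1 < n := by omega
  have hkn' : (k : ℝ) < n := by exact_mod_cast hkn
  have hn0 : (0 : ℝ) < n := by positivity
  constructor
  · intro hS hX
    -- With `d = n + k` the degrees of freedom `d - k` and `d - 2k` become `n` and `n - k`, and `2k
    -- < d` amounts to `k < n`.
    have e1 : (n : ℝ) + k - k = n := by ring
    have e2 : (n : ℝ) + k - 2 * k = n - k := by ring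
    have := identDistrib_of_density (d := n + k) hk (by linarith) hS hn0 (sampleMean x) x
      (likelihood_mul_diffusePrior hn x) L γ W rf t T (P := P) (η := η) (z₀ := z₀) (Q := Q)
      (u := u) (by rwa [e1, e2])
    rwa [e2] at this
  · intro m₀ r₀ d₀ S₀ hr hd hS₀ hX
    exact identDistrib_of_density (d := n + d₀) hk (by linarith) (posDef_scaleC hn x m₀ hr hS₀)
      (by positivity) (meanC x m₀ r₀) x (likelihood_mul_conjugatePrior hn x m₀ hr hd hS₀) L
      γ W rf t T hX
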